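/- Let $N\ge 2$ be an integer, $0<s<1$, $1<p<\infty$, and $\Psi_p(t)=|t|^{p-2}t$ (with $\Psi_p(0)=0$). Notation. $L^{p-1}_s(\mathbb{R}^N)$ is the set of measurable $u$ with $|u|^{p-1}\in L^1_{loc}(\mathbb{R}^N)$ and $\int_{\mathbb{R}^N}\frac{|u(x)|^{p-1}}{(1+|x|)^{N+sp}}\,dx<\infty$. For $V\subseteq\mathbb{R}^N$ open, $W^{s,p}(V)$ is the set of $u\in L^p(V)$ with $\int_{V\times V}\frac{|u(x)-u(y)|^p}{|x-y|^{N+sp}}\,dx\,dy<\infty$, and $u\in W^{s,p}_{loc}(U)$ means $u\in W^{s,p}(V)$ for every open $V$ whose closure is a compact subset of $U$. Let $\Omega\subseteq\mathbb{R}^N$ be open and $f:\Omega\times\mathbb{R}\to\mathbb{R}$ continuous. A function $u\in L^{p-1}_s(\mathbb{R}^N)$ is a weak super-solution (sub-solution) of $(-\Delta_p)^su=f(x,u)$ in $\Omega$ if for every bounded open $U\subseteq\Omega$ one has $u\in W^{s,p}_{loc}(U)$ and, for every non-negative $\varphi\in C_c^\infty(U)$, $$\int_{\mathbb{R}^{2N}}\frac{\Psi_p(u(x)-u(y))(\varphi(x)-\varphi(y))}{|x-y|^{N+sp}}\,dx\,dy\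 \ge\,(\le)\ \int_{\mathbb{R}^N}f(x,u(x))\varphi(x)\,dx,$$ both integrals being absolutely convergent; $u$ is a weak solution if it is both a weak super-solution and a weak sub-solution. Theorem. (a) If $ps\neq N$ and $\beta\in\left(-\frac{N}{p-1},\frac{ps}{p-1}\right)$, then $v_\beta(x)=|x|^\beta$ is a weak solution of $$(-\Delta_p)^s v_\beta=\mathcal{C}(\beta)\,|x|^{\beta(p-1)-sp}\quad\text{in }\mathbb{R}^N\setminus\{0\},$$ where $$\mathcal{C}(\beta)=4\pi\alpha_N\int_0^1\left|1-\rho^\beta\right|^{p-2}\left(1-\rho^\beta\right)\left[\rho^{N-1}-\rho^{ps-\beta(p-1)-1}\right]G(\rho^2)\,d\rho$$ (an absolutely convergent integral), with $$\alpha_N=\frac{\pi^{\frac{N-3}{2}}}{\Gamma\left(\frac{N-1}{2}\right)},\qquad G(t)=B\left(\tfrac{N-1}{2},\tfrac12\right)F\left(\tfrac{N+ps}{2},\tfrac{ps+2}{2};\tfrac N2;t\right),$$ $\Gamma$, $B$ and $F={}_2F_1$ being the gamma, beta and Gauss hypergeometric functions. Moreover, for $\beta$ in this range, $$\mathcal{C}(\beta)\begin{cases}=0&\text{if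 }\beta=0\text{ or }\beta=\frac{ps-N}{p-1},\\ >0&\text{if }\min\left\{\frac{ps-N}{p-1},0\right\}<\beta<\max\left\{\frac{ps-N}{p-1},0\right\},\\ <0&\text{otherwise.}\end{cases}$$ (b) If $ps=N$, then $v(x)=\log|x|$ is a weak solution of $(-\Delta_p)^s v=0$ in $\mathbb{R}^N\setminus\{0\}$. -/

import Mathlib

open MeasureTheory Set
open scoped ContDiff

noncomputable section

/-- The map `Ψ_p(t) = |t|^(p-2) t`. At `t = 0` the value is `0` for every `p`. -/
def psiP (p t : ℝ) : ℝ := |t| ^ (p - 2) * t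

/-- The fractional Sobolev space `W^{s,p}(V)`: the function is in `L^p(V)` and its Gagliardo
seminorm on `V × V` is finite. -/
def MemFracSobolev {N : ℕ} (s p : ℝ) (V : Set (EuclideanSpace ℝ (Fin N)))
    (u : EuclideanSpace ℝ (Fin N) → ℝ) : Prop :=
  MemLp u (ENNReal.ofReal p) (volume.restrict V) ∧
  IntegrableOn
    (fun z : EuclideanSpace ℝ (Fin N) × EuclideanSpace ℝ (Fin N) =>
      |u z.1 - u z.2| ^ p / ‖z.1 - z.2‖ ^ ((N : ℝ) + s * p))
    (V ×ˢ V) volume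

/-- The local space `W^{s,p}_loc(U)`: membership in `W^{s,p}(V)` for every open `V` that is
compactly contained in `U`. -/
def MemFracSobolevLoc {N : ℕ} (s p : ℝ) (U : Set (EuclideanSpace ℝ (Fin N)))
    (u : EuclideanSpace ℝ (Fin N) → ℝ) : Prop :=
  ∀ V : Set (EuclideanSpace ℝ (Fin N)), IsOpen V → IsCompact (closure V) → closure V ⊆ U →
    MemFracSobolev s p V u

/-- The tail space `L_s^{p-1}(ℝ^N)`. It is written out through integrability of `|u|^(p-1)`,
since `p - 1` may be smaller than `1`. -/
def MemTailSpace {N : ℕ} (s p : ℝ) (u : EuclideanSpace ℝ (Fin N) → ℝ) : Prop :=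
  AEStronglyMeasurable u volume ∧
  LocallyIntegrable (fun x => |u x| ^ (p - 1)) volume ∧
  Integrable (fun x => |u x| ^ (p - 1) / (1 + ‖x‖) ^ ((N : ℝ) + s * p)) volume

/-- Non-negative test functions in `C_c^∞(U)`. -/
def IsNonnegTest {N : ℕ} (U : Set (EuclideanSpace ℝ (Fin N)))
    (φ : EuclideanSpace ℝ (Fin N) → ℝ) : Prop :=
  ContDiff ℝ ∞ φ ∧ HasCompactSupport φ ∧ tsupport φ ⊆ U ∧ ∀ x, 0 ≤ φ x

/-- The integrand of the weak form of the fractional `p`-Laplacian of `u`, tested with `φ`. -/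
def fracPLaplaceIntegrand {N : ℕ} (s p : ℝ) (u φ : EuclideanSpace ℝ (Fin N) → ℝ)
    (z : EuclideanSpace ℝ (Fin N) × EuclideanSpace ℝ (Fin N)) : ℝ :=
  psiP p (u z.1 - u z.2) * (φ z.1 - φ z.2) / ‖z.1 - z.2‖ ^ ((N : ℝ) + s * p)

/-- `u` is a weak super-solution of `(-Δ_p)^s u = f(x,u)` in the open set `Ω`. Both sides of the
inequality are required to be genuine (absolutely convergent) integrals. -/
def IsWeakSuperSolution {N : ℕ} (s p : ℝ) (Ω : Set (EuclideanSpace ℝ (Fin N)))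
    (f : EuclideanSpace ℝ (Fin N) → ℝ → ℝ) (u : EuclideanSpace ℝ (Fin N) → ℝ) : Prop :=
  MemTailSpace s p u ∧
  ∀ U : Set (EuclideanSpace ℝ (Fin N)), IsOpen U → Bornology.IsBounded U → U ⊆ Ω →
    MemFracSobolevLoc s p U u ∧
    ∀ φ : EuclideanSpace ℝ (Fin N) → ℝ, IsNonnegTest U φ →
      Integrable (fracPLaplaceIntegrand s p u φ) volume ∧
      Integrable (fun x => f x (u x) * φ x) volume ∧
      ∫ x, f x (u x) * φ x ≤ ∫ z, fracPLaplaceIntegrand s p u φ z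

/-- `u` is a weak sub-solution of `(-Δ_p)^s u = f(x,u)` in the open set `Ω`. -/
def IsWeakSubSolution {N : ℕ} (s p : ℝ) (Ω : Set (EuclideanSpace ℝ (Fin N)))
    (f : EuclideanSpace ℝ (Fin N) → ℝ → ℝ) (u : EuclideanSpace ℝ (Fin N) → ℝ) : Prop :=
  MemTailSpace s p u ∧
  ∀ U : Set (EuclideanSpace ℝ (Fin N)), IsOpen U → Bornology.IsBounded U → U ⊆ Ω →
    MemFracSobolevLoc s p U u ∧
    ∀ φ : EuclideanSpace ℝ (Fin N) → ℝ, IsNonnegTest U φ →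
      Integrable (fracPLaplaceIntegrand s p u φ) volume ∧
      Integrable (fun x => f x (u x) * φ x) volume ∧
      ∫ z, fracPLaplaceIntegrand s p u φ z ≤ ∫ x, f x (u x) * φ x

/-- `u` is a weak solution of `(-Δ_p)^s u = f(x,u)` in `Ω`. -/
def IsWeakSolution {N : ℕ} (s p : ℝ) (Ω : Set (EuclideanSpace ℝ (Fin N)))
    (f : EuclideanSpace ℝ (Fin N) → ℝ → ℝ) (u : EuclideanSpace ℝ (Fin N) → ℝ) : Prop :=
  IsWeakSuperSolution s p Ω f u ∧ IsWeakSubSolution s p Ω f u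

/-- `α_N = π^((N-3)/2) / Γ((N-1)/2)`. -/
def alphaN (N : ℕ) : ℝ :=
  Real.pi ^ (((N : ℝ) - 3) / 2) / Real.Gamma (((N : ℝ) - 1) / 2)

/-- `G(t) = B((N-1)/2, 1/2) F((N+ps)/2, (ps+2)/2; N/2; t)`, where `B` is the beta function and
`F` the Gauss hypergeometric function. The last argument is `t`, the argument `q` is `ps`. -/
def hyperG (N : ℕ) (q t : ℝ) : ℝ :=
  ProbabilityTheory.beta (((N : ℝ) - 1) / 2) (1 / 2) *
    ordinaryHypergeometric (((N : ℝ) + q) / 2) ((q + 2) / 2) ((N : ℝ) / 2) t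

/-- The integrand in the definition of the constant `C(β)`. -/
def constIntegrand (N : ℕ) (s p β ρ : ℝ) : ℝ :=
  |1 - ρ ^ β| ^ (p - 2) * (1 - ρ ^ β) *
    (ρ ^ ((N : ℝ) - 1) - ρ ^ (p * s - β * (p - 1) - 1)) * hyperG N (p * s) (ρ ^ 2)

/-- The constant `C(β)`. -/
def constC (N : ℕ) (s p β : ℝ) : ℝ :=
  4 * Real.pi * alphaN N * ∫ ρ in (0 : ℝ)..1, constIntegrand N s p β ρ

end

/-!
For a radial function `u(x) = g(|x|)` the weak form is a principal value, and the point of the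
proof is to truncate it in a way that respects its symmetries: instead of removing `|x - y| < ε`,
only the pairs with `|x| ≤ δ |y|` or `|y| ≤ δ |x|` are kept (`ratioSet`), and `δ` tends to `1`.
The pairs lost in the limit have `|x| = |y|`, where the integrand is zero, so dominated
convergence suffices.

On the truncated set the integrand may be split, and by symmetry the form equals `2 ∫ φ(x) I_δ(x)
dx`, where `I_δ(x)` is the integral over `y` of `Ψ_p(u(x) - u(y)) |x - y|^(-N-sp)`. Both `g(r) =
r^β` and `g(r) = log r` (with `β = 0`) satisfy `g(R) - g(Rρ) = R^β (g(1) - g(ρ))`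
(`IsHomogeneousProfile`). In polar coordinates, scaling by `|x|` and mapping `|y| / |x| > 1` to
its inverse give `I_δ(x) = |x|^(β(p-1)-sp) ∫_0^δ profileDensity` (`truncated_slice_eq`). In this
density the contributions of `ρ` and `ρ⁻¹` form the bracket `ρ^(N-1) - ρ^(sp-β(p-1)-1)`, whose
zero at `ρ = 1` makes the density integrable on `(0, 1)` (`integrableOn_profileDensity`). Bounds
at `ρ = 1` are obtained by going back to integrals over `ℝ^N`, so that no asymptotics of the
hypergeometric function are needed.

The angular integral of `|e - ρ w|^(-N-sp)` is the hypergeometric factor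
(`integral_sphere_norm_sub_rpow`). It is computed by a binomial expansion, with the moments of a
coordinate on the sphere taken from Gaussian integrals, and by the quadratic transformation of `F`
(`hasSum_quadratic`), which for small arguments is a rearrangement of a double series and the
Chu-Vandermonde identity, and extends by analyticity.

The sign of the constant is read off the density: `Ψ_p(1 - ρ^β)` has the sign of `β`, the bracket
that of `(ps-N)/(p-1) - β`, and the hypergeometric factor is positive. For `ps = N` and `β = 0`
the bracket vanishes identically, which is the logarithmic case.
-/

/-! ### The Gauss hypergeometric function -/

lemma hasSum_one_sub_rpow_neg (a : ℝ) {x : ℝ} (hx : |x| < 1) :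
    HasSum (fun n : ℕ => (ascPochhammer ℝ n).eval a / n.factorial * x ^ n) ((1 - x) ^ (-a)) := by
  have h := (Real.one_add_rpow_hasFPowerSeriesOnBall_zero (a := -a)).hasSum (y := -x)
    (by simp [enorm_eq_nnnorm]; exact_mod_cast hx)
  rw [binomialSeries_eq_ordinaryHypergeometricSeries (b := (1:ℝ))
    (by intro k; have : (0:ℝ) ≤ k := k.cast_nonneg; linarith)] at h
  rw [zero_add, ← sub_eq_add_neg] at h
  refine h.congr_fun fun n => ?_
  have h1 : (ascPochhammer ℝ n).eval 1 ≠ 0 := (ascPochhammer_pos n 1 one_pos).ne'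
  rw [FormalMultilinearSeries.compContinuousLinearMap_apply]
  have h2 : (⇑(-ContinuousLinearMap.id ℝ ℝ) ∘ fun _ : Fin n => -x) = fun _ => x := by
    ext; simp
  rw [h2, ordinaryHypergeometricSeries_apply_eq, neg_neg, smul_eq_mul]
  field_simp

/-- With positive parameters the radius of convergence is `1`, so that no junk value occurs below.
-/
lemma radius_ordinaryHypergeometricSeries_of_pos {a b c : ℝ} (ha : 0 < a) (hb : 0 < b)
    (hc : 0 < c) : (ordinaryHypergeometricSeries ℝ a b c).radius = 1 := by
  apply ordinaryHypergeometricSeries_radius_eq_one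
  intro k
  have : (0:ℝ) ≤ k := k.cast_nonneg
  refine ⟨?_, ?_, ?_⟩ <;> linarith

lemma hasSum_ordinaryHypergeometric {a b c : ℝ} (ha : 0 < a) (hb : 0 < b) (hc : 0 < c) {x : ℝ}
    (hx : |x| < 1) :
    HasSum (fun n : ℕ => (ascPochhammer ℝ n).eval a * (ascPochhammer ℝ n).eval b /
      (n.factorial * (ascPochhammer ℝ n).eval c) * x ^ n) (ordinaryHypergeometric a b c x) := by
  have h := (ordinaryHypergeometricSeries ℝ a b c).hasSum (x := x)
    (by rw [radius_ordinaryHypergeometricSeries_of_pos ha hb hc]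
        simp [enorm_eq_nnnorm]; exact_mod_cast hx)
  refine h.congr_fun fun n => ?_
  rw [ordinaryHypergeometricSeries_apply_eq, smul_eq_mul]
  have h3 := (ascPochhammer_pos n c hc).ne'
  field_simp

lemma analyticAt_ordinaryHypergeometric {a b c : ℝ} (ha : 0 < a) (hb : 0 < b) (hc : 0 < c) {x : ℝ}
    (hx : |x| < 1) : AnalyticAt ℝ (fun y : ℝ => ordinaryHypergeometric a b c y) x := by
  have hr := radius_ordinaryHypergeometricSeries_of_pos ha hb hc
  have := (ordinaryHypergeometricSeries ℝ a b c).hasFPowerSeriesOnBall (by rw [hr]; simp)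
  exact this.analyticAt_of_mem (by rw [hr]; simp [enorm_eq_nnnorm]; exact_mod_cast hx)

lemma ordinaryHypergeometric_pos {a b c : ℝ} (ha : 0 < a) (hb : 0 < b) (hc : 0 < c) {x : ℝ}
    (hx0 : 0 ≤ x) (hx : x < 1) : 0 < ordinaryHypergeometric a b c x := by
  have h := hasSum_ordinaryHypergeometric ha hb hc (x := x) (by rwa [abs_of_nonneg hx0])
  rw [← h.tsum_eq]
  refine h.summable.tsum_pos (fun n => ?_) 0 (by simp)
  have h1 := ascPochhammer_pos n a ha
  have h2 := ascPochhammer_pos n b hb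
  have h3 := ascPochhammer_pos n c hc
  positivity

/-- The Chu-Vandermonde identity for rising factorials. -/
lemma ascPochhammer_eval_add_eq_sum (a b : ℝ) (n : ℕ) :
    (ascPochhammer ℝ n).eval (a + b) = ∑ ij ∈ Finset.HasAntidiagonal.antidiagonal n,
      (n.choose ij.1 : ℝ) * ((ascPochhammer ℝ ij.1).eval a * (ascPochhammer ℝ ij.2).eval b) := by
  induction n with
  | zero => simp
  | succ n ih =>
    rw [Finset.sum_antidiagonal_choose_succ_mul
      (fun i j => (ascPochhammer ℝ i).eval a * (ascPochhammer ℝ j).eval b),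
      ascPochhammer_succ_eval, ih, Finset.sum_mul, ← Finset.sum_add_distrib]
    refine Finset.sum_congr rfl fun ij hij => ?_
    have hn : ij.1 + ij.2 = n := by simpa using hij
    have hc : n.choose ij.2 = n.choose ij.1 := Nat.choose_symm_of_eq_add (by omega)
    rw [hc, ascPochhammer_succ_eval, ascPochhammer_succ_eval, ← hn]
    push_cast
    ring

lemma ascPochhammer_eval_two_mul (a : ℝ) (j : ℕ) :
    (ascPochhammer ℝ (2 * j)).eval a = 4 ^ j * (ascPochhammer ℝ j).eval (a / 2) *
      (ascPochhammer ℝ j).eval ((a + 1) / 2) := by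
  induction j with
  | zero => simp
  | succ j ih =>
    rw [show 2 * (j + 1) = 2 * j + 1 + 1 by ring, ascPochhammer_succ_eval, ascPochhammer_succ_eval,
      ih, ascPochhammer_succ_eval, ascPochhammer_succ_eval]
    push_cast
    ring

lemma ascPochhammer_eval_add_nat (a : ℝ) (n m : ℕ) :
    (ascPochhammer ℝ (n + m)).eval a =
      (ascPochhammer ℝ n).eval a * (ascPochhammer ℝ m).eval (a + n) := by
  rw [← ascPochhammer_mul]; simp

/-- Reflection of a rising factorial. -/
lemma ascPochhammer_eval_one_sub (a : ℝ) (m : ℕ) :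
    (ascPochhammer ℝ m).eval (1 - a - m) = (-1) ^ m * (ascPochhammer ℝ m).eval a := by
  have h := ascPochhammer_eval_neg_eq_descPochhammer ℝ (-a) m
  rw [neg_neg, descPochhammer_eval_eq_ascPochhammer] at h
  rw [h, ← mul_assoc, ← mul_pow]
  simp only [mul_neg, mul_one, neg_neg, one_pow, one_mul]
  congr 1; ring

/-- The coefficient of `x ^ n` in the quadratic transformation. It is a Chu-Vandermonde sum with
parameters `a + n` and `1 - c - n`. -/
lemma sum_antidiagonal_quadratic {a c : ℝ} (hc : 0 < c) (n : ℕ) :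
    ∑ ij ∈ Finset.HasAntidiagonal.antidiagonal n, (ascPochhammer ℝ (2 * ij.1 + ij.2)).eval a /
      (ij.1.factorial * ij.2.factorial * (ascPochhammer ℝ ij.1).eval c) * (-1) ^ ij.2 =
    (ascPochhammer ℝ n).eval a * (ascPochhammer ℝ n).eval (a + 1 - c) /
      (n.factorial * (ascPochhammer ℝ n).eval c) := by
  have hcn := (ascPochhammer_pos n c hc).ne'
  rw [show a + 1 - c = (a + n) + (1 - c - n) by ring, ascPochhammer_eval_add_eq_sum,
    Finset.mul_sum, Finset.sum_div]
  refine Finset.sum_congr rfl fun ij hij => ?_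
  obtain ⟨i, j⟩ := ij
  have hn : i + j = n := by simpa using hij
  subst hn
  have hci := (ascPochhammer_pos i c hc).ne'
  have hcj := (ascPochhammer_pos j (c + i) (by positivity)).ne'
  have e1 : (ascPochhammer ℝ (2 * i + j)).eval a =
      (ascPochhammer ℝ (i + j)).eval a * (ascPochhammer ℝ i).eval (a + (i + j : ℕ)) := by
    rw [← ascPochhammer_eval_add_nat]; congr 2; ring
  have e2 : (ascPochhammer ℝ j).eval (1 - c - (i + j : ℕ)) =
      (-1) ^ j * (ascPochhammer ℝ j).eval (c + i) := by
    rw [← ascPochhammer_eval_one_sub]; congr 1; push_cast; ring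
  have e3 := ascPochhammer_eval_add_nat c i j
  have e4 : (((i + j).choose i : ℕ) : ℝ) * i.factorial * j.factorial = (i + j).factorial := by
    have := Nat.add_choose_mul_factorial_mul_factorial i j
    rw [Nat.choose_symm_add]
    exact_mod_cast this
  have hf1 : (i.factorial : ℝ) ≠ 0 := by positivity
  have hf2 : (j.factorial : ℝ) ≠ 0 := by positivity
  have e5 : (((i + j).choose i : ℕ) : ℝ) = (i + j).factorial / (i.factorial * j.factorial) := by
    rw [← e4]; field_simp
  dsimp only
  rw [e1, e2, e3, e5]
  field_simp

lemma hasSum_quadratic_of_abs_lt {a c x : ℝ} (ha : 0 < a) (hc : 0 < c) (hb : 0 < a + 1 - c)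
    (hx : |x| < 1 / 10) :
    HasSum (fun j : ℕ => (ascPochhammer ℝ (2 * j)).eval a /
      (j.factorial * (ascPochhammer ℝ j).eval c) * x ^ j * (1 + x) ^ (-(a + (2 * j : ℕ))))
      (ordinaryHypergeometric a (a + 1 - c) c x) := by
  set T : ℕ × ℕ → ℝ := fun ij => (ascPochhammer ℝ (2 * ij.1 + ij.2)).eval a /
      (ij.1.factorial * ij.2.factorial * (ascPochhammer ℝ ij.1).eval c) * x ^ ij.1 * (-x) ^ ij.2
    with hT
  have key : ∀ (j : ℕ) (y z : ℝ), |z| < 1 → HasSum (fun m : ℕ =>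
      (ascPochhammer ℝ (2 * j + m)).eval a /
      (j.factorial * m.factorial * (ascPochhammer ℝ j).eval c) * y ^ j * z ^ m)
      ((ascPochhammer ℝ (2 * j)).eval a /
      (j.factorial * (ascPochhammer ℝ j).eval c) * y ^ j * (1 - z) ^ (-(a + (2 * j : ℕ)))) := by
    intro j y z hz
    have h := (hasSum_one_sub_rpow_neg (a + (2 * j : ℕ)) hz).mul_left
      ((ascPochhammer ℝ (2 * j)).eval a / (j.factorial * (ascPochhammer ℝ j).eval c) * y ^ j)
    refine h.congr_fun fun m => ?_
    rw [ascPochhammer_eval_add_nat]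
    have := (ascPochhammer_pos j c hc).ne'
    field_simp
  have hx1 : |x| < 1 := by linarith
  have hTn : ∀ ij, ‖T ij‖ = (ascPochhammer ℝ (2 * ij.1 + ij.2)).eval a /
      (ij.1.factorial * ij.2.factorial * (ascPochhammer ℝ ij.1).eval c) * |x| ^ ij.1 *
        |x| ^ ij.2 := by
    intro ij
    have h1 := ascPochhammer_pos (2 * ij.1 + ij.2) a ha
    have h2 := ascPochhammer_pos ij.1 c hc
    simp only [hT, norm_mul, norm_pow, Real.norm_eq_abs, abs_neg]
    rw [abs_of_pos (by positivity)]
  have hS : Summable T := by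
    apply Summable.of_norm
    rw [summable_prod_of_nonneg (fun _ => norm_nonneg _)]
    simp_rw [hTn]
    refine ⟨fun j => (key j |x| |x| (by rwa [abs_abs])).summable, ?_⟩
    simp_rw [fun j => (key j |x| |x| (by rwa [abs_abs])).tsum_eq]
    have hw : |4 * |x| / (1 - |x|) ^ 2| < 1 := by
      rw [abs_of_nonneg (by positivity), div_lt_one (by nlinarith [abs_nonneg x])]
      nlinarith [abs_nonneg x]
    have h := ((hasSum_ordinaryHypergeometric (a := a / 2) (b := (a + 1) / 2) (by positivity)
      (by positivity) hc hw).summable).mul_left ((1 - |x|) ^ (-a))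
    refine h.congr fun j => ?_
    have hp : 0 < 1 - |x| := by linarith
    rw [ascPochhammer_eval_two_mul, neg_add, Real.rpow_add hp, Real.rpow_neg hp.le (_ : ℕ),
      Real.rpow_natCast, div_pow, mul_pow, ← pow_mul]
    field_simp
  have h1 : HasSum T (∑' j : ℕ, (ascPochhammer ℝ (2 * j)).eval a /
      (j.factorial * (ascPochhammer ℝ j).eval c) * x ^ j * (1 + x) ^ (-(a + (2 * j : ℕ)))) := by
    have h2 := fun j => key j x (-x) (by rwa [abs_neg])
    simp only [sub_neg_eq_add] at h2
    have := hS.hasSum.prod_fiberwise h2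
    rw [this.tsum_eq]; exact hS.hasSum
  have h3 : HasSum (fun j : ℕ => (ascPochhammer ℝ (2 * j)).eval a /
      (j.factorial * (ascPochhammer ℝ j).eval c) * x ^ j * (1 + x) ^ (-(a + (2 * j : ℕ))))
      (∑' ij, T ij) := by
    have h2 := fun j => key j x (-x) (by rwa [abs_neg])
    simp only [sub_neg_eq_add] at h2
    exact hS.hasSum.prod_fiberwise h2
  convert! h3 using 1
  have hS' := (Finset.HasAntidiagonal.sigmaAntidiagonalEquivProd (A := ℕ)).summable_iff.mpr hS
  have h4 := ((Finset.HasAntidiagonal.sigmaAntidiagonalEquivProd (A := ℕ)).hasSum_iff.mpr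
    hS.hasSum).sigma (fun n => hasSum_fintype _)
  refine (hasSum_ordinaryHypergeometric ha hb hc hx1).unique
    (h4.congr_fun fun n => ?_)
  simp only [Function.comp_def, Finset.HasAntidiagonal.sigmaAntidiagonalEquivProd_apply]
  rw [Finset.univ_eq_attach, Finset.sum_attach (Finset.HasAntidiagonal.antidiagonal n) T,
    ← sum_antidiagonal_quadratic hc, Finset.sum_mul]
  refine Finset.sum_congr rfl fun ij hij => ?_
  have hn : ij.1 + ij.2 = n := by simpa using hij
  rw [← hn, hT]
  simp only
  rw [neg_pow x, pow_add]
  ring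

/-- Quadratic transformation `F(a, a+1-c; c; x) = (1+x)^(-a) F(a/2, (a+1)/2; c; 4x/(1+x)^2)`, with
the right-hand side expanded in powers of `x / (1+x)^2`. The double series obtained by expanding
the powers of `1 + x` converges only for small `x`; the identity theorem gives the rest. -/
lemma hasSum_quadratic {a c x : ℝ} (ha : 0 < a) (hc : 0 < c) (hb : 0 < a + 1 - c)
    (hx0 : 0 ≤ x) (hx : x < 1) :
    HasSum (fun j : ℕ => (ascPochhammer ℝ (2 * j)).eval a /
      (j.factorial * (ascPochhammer ℝ j).eval c) * x ^ j * (1 + x) ^ (-(a + (2 * j : ℕ))))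
      (ordinaryHypergeometric a (a + 1 - c) c x) := by
  have hw : ∀ y ∈ Ioo (-(1/10) : ℝ) 1, |4 * y / (1 + y) ^ 2| < 1 := by
    rintro y ⟨h1, h2⟩
    have hp : 0 < (1 + y) ^ 2 := by nlinarith
    rw [abs_div, abs_of_pos hp, div_lt_one hp, abs_lt]
    constructor <;> nlinarith
  have hsum : ∀ y ∈ Ioo (-(1/10) : ℝ) 1, HasSum (fun j : ℕ => (ascPochhammer ℝ (2 * j)).eval a /
      (j.factorial * (ascPochhammer ℝ j).eval c) * y ^ j * (1 + y) ^ (-(a + (2 * j : ℕ))))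
      ((1 + y) ^ (-a) * ordinaryHypergeometric (a / 2) ((a + 1) / 2) c (4 * y / (1 + y) ^ 2)) := by
    intro y hy
    have h := (hasSum_ordinaryHypergeometric (a := a / 2) (b := (a + 1) / 2) (by positivity)
      (by positivity) hc (hw y hy)).mul_left ((1 + y) ^ (-a))
    refine h.congr_fun fun j => ?_
    have hp : 0 < 1 + y := by linarith [hy.1]
    rw [ascPochhammer_eval_two_mul, neg_add, Real.rpow_add hp, Real.rpow_neg hp.le (_ : ℕ),
      Real.rpow_natCast, div_pow, mul_pow, ← pow_mul]
    field_simp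
  have hA : AnalyticOnNhd ℝ (fun y : ℝ => (1 + y) ^ (-a) *
      ordinaryHypergeometric (a / 2) ((a + 1) / 2) c (4 * y / (1 + y) ^ 2)) (Ioo (-(1/10)) 1) := by
    intro y hy
    have hp : 0 < 1 + y := by linarith [hy.1]
    have h1 : AnalyticAt ℝ (fun y : ℝ => 1 + y) y := by fun_prop
    refine AnalyticAt.mul ?_ ?_
    · exact (ContDiffAt.rpow_const_of_ne (n := ω) h1.contDiffAt hp.ne').analyticAt
    · refine (analyticAt_ordinaryHypergeometric (by positivity) (by positivity) hc
        (hw y hy)).fun_comp (f := fun y : ℝ => 4 * y / (1 + y) ^ 2) ?_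
      exact (by fun_prop : AnalyticAt ℝ (fun y : ℝ => 4 * y) y).div (h1.pow 2) (by positivity)
  have hB : AnalyticOnNhd ℝ (fun y : ℝ => ordinaryHypergeometric a (a + 1 - c) c y)
      (Ioo (-(1/10)) 1) := by
    intro y hy
    exact analyticAt_ordinaryHypergeometric ha hb hc (abs_lt.2 ⟨by linarith [hy.1], hy.2⟩)
  have hE := hA.eqOn_of_preconnected_of_eventuallyEq hB isPreconnected_Ioo (z₀ := 0)
    (by norm_num) (by
      have : Ioo (-(1/10) : ℝ) (1/10) ∈ nhds 0 := Ioo_mem_nhds (by norm_num) (by norm_num)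
      filter_upwards [this] with y hy
      exact (hsum y ⟨hy.1, by linarith [hy.2]⟩).unique
        (hasSum_quadratic_of_abs_lt ha hc hb (abs_lt.2 hy)))
  have hx' : x ∈ Ioo (-(1/10) : ℝ) 1 := ⟨by linarith, hx⟩
  rw [← show _ = ordinaryHypergeometric a (a + 1 - c) c x from hE hx']
  exact hsum x hx'

/-! ### Polar coordinates -/

section Polar

variable {E : Type*} [NormedAddCommGroup E] [NormedSpace ℝ E] [MeasurableSpace E] [BorelSpace E]
  [FiniteDimensional ℝ E] (μ : Measure E) [μ.IsAddHaarMeasure]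

lemma measurePreserving_prodMap_val (n : ℕ) :
    MeasurePreserving (Prod.map id (Subtype.val : Ioi (0 : ℝ) → ℝ))
      (μ.toSphere.prod (Measure.volumeIoiPow n))
      (μ.toSphere.prod ((volume.restrict (Ioi 0)).withDensity fun r => .ofReal (r ^ n))) := by
  refine MeasurePreserving.prod (MeasurePreserving.id _) ⟨measurable_subtype_coe, ?_⟩
  have he := MeasurableEmbedding.subtype_coe (measurableSet_Ioi (a := (0 : ℝ)))
  ext t ht
  rw [he.map_apply, Measure.volumeIoiPow, withDensity_apply _ ht,
    withDensity_apply _ (measurable_subtype_coe ht), ← map_comap_subtype_coe measurableSet_Ioi,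
    he.restrict_map, he.lintegral_map]

variable [Nontrivial E]

/-- Polar coordinates, with the radial variable in `ℝ` and the Jacobian as an explicit factor. -/
lemma integrable_polar_iff (f : E → ℝ) :
    Integrable f μ ↔ Integrable (fun z : Metric.sphere (0 : E) 1 × ℝ =>
      z.2 ^ (Module.finrank ℝ E - 1) * f (z.2 • (z.1 : E)))
      (μ.toSphere.prod (volume.restrict (Ioi 0))) := by
  set n := Module.finrank ℝ E - 1
  have h1 := μ.measurePreserving_homeomorphUnitSphereProd
  have he := MeasurableEmbedding.subtype_coe (measurableSet_Ioi (a := (0 : ℝ)))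
  have h2 := measurePreserving_prodMap_val μ n
  have e0 : Integrable f μ ↔
      Integrable (f ∘ (Subtype.val : ({0}ᶜ : Set E) → E)) (μ.comap Subtype.val) := by
    rw [← integrableOn_iff_comap_subtypeVal (measurableSet_singleton _).compl, IntegrableOn,
      restrict_compl_singleton]
  have e1 : f ∘ (Subtype.val : ({0}ᶜ : Set E) → E) =
      ((fun z : Metric.sphere (0 : E) 1 × ℝ => f (z.2 • (z.1 : E))) ∘
        Prod.map id (Subtype.val : Ioi (0 : ℝ) → ℝ)) ∘ homeomorphUnitSphereProd E := by
    ext x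
    have hx : ‖(x : E)‖ ≠ 0 := norm_ne_zero_iff.2 x.2
    simp [smul_smul, hx]
  rw [e0, e1]
  refine (h1.integrable_comp_emb (Homeomorph.measurableEmbedding _)
    (g := (fun z : Metric.sphere (0 : E) 1 × ℝ => f (z.2 • (z.1 : E))) ∘
        Prod.map id (Subtype.val : Ioi (0 : ℝ) → ℝ))).trans
    ((h2.integrable_comp_emb (MeasurableEmbedding.id.prodMap he)
      (g := fun z : Metric.sphere (0 : E) 1 × ℝ => f (z.2 • (z.1 : E)))).trans ?_)
  rw [prod_withDensity_right (by fun_prop), integrable_withDensity_iff_integrable_smul'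
    (by fun_prop) (by simp)]
  apply integrable_congr
  have : ∀ᵐ z ∂(μ.toSphere.prod (volume.restrict (Ioi (0 : ℝ)))), 0 < z.2 :=
    Measure.quasiMeasurePreserving_snd.ae (ae_restrict_mem measurableSet_Ioi)
  filter_upwards [this] with z hz
  simp [ENNReal.toReal_ofReal (pow_nonneg hz.le n)]

lemma integral_polar (f : E → ℝ) :
    ∫ x, f x ∂μ = ∫ z : Metric.sphere (0 : E) 1 × ℝ,
      z.2 ^ (Module.finrank ℝ E - 1) * f (z.2 • (z.1 : E))
      ∂(μ.toSphere.prod (volume.restrict (Ioi 0))) := by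
  set n := Module.finrank ℝ E - 1
  have h1 := μ.measurePreserving_homeomorphUnitSphereProd
  have he := MeasurableEmbedding.subtype_coe (measurableSet_Ioi (a := (0 : ℝ)))
  have h2 := measurePreserving_prodMap_val μ n
  set F : Metric.sphere (0 : E) 1 × ℝ → ℝ := fun z => f (z.2 • (z.1 : E)) with hF
  have e1 : ∫ x, f x ∂μ = ∫ x : ({0}ᶜ : Set E), F (Prod.map id (Subtype.val : Ioi (0 : ℝ) → ℝ)
      (homeomorphUnitSphereProd E x)) ∂(μ.comap Subtype.val) := by
    rw [← restrict_compl_singleton (μ := μ) 0,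
      ← integral_subtype_comap (measurableSet_singleton _).compl, restrict_compl_singleton]
    refine integral_congr_ae (Filter.Eventually.of_forall fun x => ?_)
    have hx : ‖(x : E)‖ ≠ 0 := norm_ne_zero_iff.2 x.2
    simp [hF, smul_smul, hx]
  rw [e1, h1.integral_comp (Homeomorph.measurableEmbedding _)
      (fun w => F (Prod.map id (Subtype.val : Ioi (0 : ℝ) → ℝ) w)),
    h2.integral_comp (MeasurableEmbedding.id.prodMap he),
    prod_withDensity_right (by fun_prop), integral_withDensity_eq_integral_toReal_smul (by fun_prop)
      (by simp)]
  refine integral_congr_ae ?_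
  have : ∀ᵐ z ∂(μ.toSphere.prod (volume.restrict (Ioi (0 : ℝ)))), 0 < z.2 :=
    Measure.quasiMeasurePreserving_snd.ae (ae_restrict_mem measurableSet_Ioi)
  filter_upwards [this] with z hz
  simp [hF, ENNReal.toReal_ofReal (pow_nonneg hz.le n)]

end Polar

/-! ### Moments of a coordinate on the sphere -/

/-- The surface area `2 π^(N/2) / Γ(N/2)` of the unit sphere of `ℝ^N`. -/
noncomputable def sphereArea (N : ℕ) : ℝ :=
  2 * Real.pi ^ ((N : ℝ) / 2) / Real.Gamma ((N : ℝ) / 2)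

lemma sphereArea_pos {N : ℕ} (hN : 0 < N) : 0 < sphereArea N := by
  have : 0 < Real.Gamma ((N : ℝ) / 2) := Real.Gamma_pos_of_pos (by positivity)
  unfold sphereArea; positivity

lemma Gamma_add_nat_eq_ascPochhammer {a : ℝ} (ha : 0 < a) (j : ℕ) :
    Real.Gamma (a + j) = (ascPochhammer ℝ j).eval a * Real.Gamma a := by
  induction j with
  | zero => simp
  | succ j ih =>
    rw [Nat.cast_succ, ← add_assoc, Real.Gamma_add_one (by positivity), ih, ascPochhammer_succ_eval]
    ring

lemma integral_pow_mul_exp_neg_sq_even (j : ℕ) :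
    ∫ t : ℝ, t ^ (2 * j) * Real.exp (-t ^ 2) = Real.Gamma (1 / 2 + j) := by
  have h := integral_comp_abs (f := fun t : ℝ => t ^ (2 * j) * Real.exp (-t ^ 2))
  simp only [sq_abs, pow_mul] at h
  have h2 := integral_rpow_mul_exp_neg_rpow (p := 2) (q := (2 * j : ℕ)) two_pos
    (by have : (0 : ℝ) ≤ (2 * j : ℕ) := by positivity
        linarith)
  simp only [Real.rpow_natCast, Real.rpow_two, pow_mul] at h2
  simp only [pow_mul]
  rw [h, h2, show (((2 * j : ℕ) : ℝ) + 1) / 2 = 1 / 2 + j by push_cast; ring]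
  ring

lemma integral_pow_mul_exp_neg_sq_odd (j : ℕ) :
    ∫ t : ℝ, t ^ (2 * j + 1) * Real.exp (-t ^ 2) = 0 := by
  have h := integral_neg_eq_self (fun t : ℝ => t ^ (2 * j + 1) * Real.exp (-t ^ 2)) volume
  simp only [neg_sq, Odd.neg_pow ⟨j, rfl⟩, neg_mul, integral_neg] at h
  linarith

section Sphere

variable {N : ℕ}

/-- A Gaussian moment of a linear coordinate factors over an orthonormal basis containing `e`. -/
lemma integral_inner_pow_mul_exp (e : EuclideanSpace ℝ (Fin N)) (he : ‖e‖ = 1) (k : ℕ) :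
    ∫ x : EuclideanSpace ℝ (Fin N), (inner ℝ e x) ^ k * Real.exp (-‖x‖ ^ 2) =
      (∫ t : ℝ, t ^ k * Real.exp (-t ^ 2)) * Real.pi ^ (((N : ℝ) - 1) / 2) := by
  have hN : 0 < N := by
    rcases Nat.eq_zero_or_pos N with rfl | h
    · rw [Subsingleton.elim e 0] at he; simp at he
    · exact h
  let i0 : Fin N := ⟨0, hN⟩
  obtain ⟨b, hb⟩ := Orthonormal.exists_orthonormalBasis_extension_of_card_eq (𝕜 := ℝ)
    (E := EuclideanSpace ℝ (Fin N)) (ι := Fin N) (by simp) (v := fun _ => e) (s := {i0}) (by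
      rw [orthonormal_iff_ite]
      rintro ⟨i, hi⟩ ⟨j, hj⟩
      have : i = j := by rw [hi, hj]
      subst this
      simp [he])
  have hb0 : b i0 = e := hb i0 rfl
  let g : EuclideanSpace ℝ (Fin N) → ℝ := fun y => (y i0) ^ k * Real.exp (-‖y‖ ^ 2)
  have e1 : ∀ x, (inner ℝ e x) ^ k * Real.exp (-‖x‖ ^ 2) = g (b.repr x) := by
    intro x
    simp only [g, LinearIsometryEquiv.norm_map, b.repr_apply_apply, hb0]
  simp_rw [e1]
  rw [b.measurePreserving_repr.integral_comp b.repr.toHomeomorph.measurableEmbedding,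
    ← (EuclideanSpace.volume_preserving_symm_measurableEquiv_toLp (Fin N)).symm.integral_comp
      (MeasurableEquiv.measurableEmbedding _)]
  have e2 : ∀ y : Fin N → ℝ, g ((MeasurableEquiv.toLp 2 (Fin N → ℝ)).symm.symm y) =
      ∏ i, (if i = i0 then (y i) ^ k else 1) * Real.exp (-(y i) ^ 2) := by
    intro y
    rw [Finset.prod_mul_distrib]
    simp [g, EuclideanSpace.norm_sq_eq, Real.exp_sum, ← Finset.sum_neg_distrib]
  simp_rw [e2]
  rw [integral_fintype_prod_volume_eq_prod
    (fun i (t : ℝ) => (if i = i0 then t ^ k else 1) * Real.exp (-t ^ 2)),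
    ← Finset.mul_prod_erase _ _ (Finset.mem_univ i0)]
  refine congrArg₂ (· * ·) (by simp) ?_
  · have : ∀ i ∈ Finset.univ.erase i0, (∫ t : ℝ, (if i = i0 then t ^ k else 1) * Real.exp (-t ^ 2))
        = Real.pi ^ ((1 : ℝ) / 2) := by
      intro i hi
      have := integral_gaussian 1
      simp only [neg_mul, one_mul, div_one] at this
      simp [Finset.ne_of_mem_erase hi, this, Real.sqrt_eq_rpow]
    rw [Finset.prod_congr rfl this, Finset.prod_const, ← Real.rpow_natCast, ← Real.rpow_mul
      Real.pi_pos.le]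
    congr 1
    simp [Finset.card_erase_of_mem, Nat.cast_sub hN]
    ring

/-- Polar coordinates in a Gaussian integral relate the moments of a coordinate on the sphere to
those of the one-dimensional Gaussian. -/
lemma integral_sphere_inner_pow (e : EuclideanSpace ℝ (Fin N)) (he : ‖e‖ = 1) (k : ℕ) :
    (∫ w : Metric.sphere (0 : EuclideanSpace ℝ (Fin N)) 1,
      (inner ℝ e (w : EuclideanSpace ℝ (Fin N))) ^ k
      ∂(volume : Measure (EuclideanSpace ℝ (Fin N))).toSphere) * (Real.Gamma ((N + k : ℝ) / 2) / 2)
      = (∫ t : ℝ, t ^ k * Real.exp (-t ^ 2)) * Real.pi ^ (((N : ℝ) - 1) / 2) := by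
  have hN : 0 < N := by
    rcases Nat.eq_zero_or_pos N with rfl | h
    · rw [Subsingleton.elim e 0] at he; simp at he
    · exact h
  have : Nontrivial (EuclideanSpace ℝ (Fin N)) := ⟨e, 0, by rintro rfl; simp at he⟩
  rw [← integral_inner_pow_mul_exp e he,
    integral_polar (volume : Measure (EuclideanSpace ℝ (Fin N)))]
  have h2 := integral_rpow_mul_exp_neg_rpow (p := 2) (q := (N - 1 + k : ℕ)) two_pos
    (by have : (0 : ℝ) ≤ (N - 1 + k : ℕ) := by positivity
        linarith)
  simp only [Real.rpow_natCast, Real.rpow_two] at h2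
  rw [show (((N - 1 + k : ℕ) : ℝ) + 1) / 2 = (N + k : ℝ) / 2 by
    rw [Nat.cast_add, Nat.cast_sub hN]; push_cast; ring] at h2
  rw [show Real.Gamma ((N + k : ℝ) / 2) / 2 = 1 / 2 * Real.Gamma ((N + k : ℝ) / 2) by ring, ← h2,
    ← integral_prod_mul]
  refine integral_congr_ae (Filter.Eventually.of_forall fun z => ?_)
  have : ‖z.2 • (z.1 : EuclideanSpace ℝ (Fin N))‖ ^ 2 = z.2 ^ 2 := by
    simp [norm_smul]
  simp only [this, inner_smul_right, finrank_euclideanSpace, Fintype.card_fin, mul_pow, pow_add]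
  ring

lemma integral_sphere_inner_pow_odd (e : EuclideanSpace ℝ (Fin N)) (he : ‖e‖ = 1) (j : ℕ) :
    ∫ w : Metric.sphere (0 : EuclideanSpace ℝ (Fin N)) 1,
      (inner ℝ e (w : EuclideanSpace ℝ (Fin N))) ^ (2 * j + 1)
      ∂(volume : Measure (EuclideanSpace ℝ (Fin N))).toSphere = 0 := by
  have h := integral_sphere_inner_pow e he (2 * j + 1)
  rw [integral_pow_mul_exp_neg_sq_odd, zero_mul] at h
  have : 0 < Real.Gamma ((N + (2 * j + 1 : ℕ) : ℝ) / 2) := Real.Gamma_pos_of_pos (by positivity)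
  rcases mul_eq_zero.1 h with h | h
  · exact h
  · linarith

lemma integral_sphere_inner_pow_even (e : EuclideanSpace ℝ (Fin N)) (he : ‖e‖ = 1) (j : ℕ) :
    ∫ w : Metric.sphere (0 : EuclideanSpace ℝ (Fin N)) 1,
      (inner ℝ e (w : EuclideanSpace ℝ (Fin N))) ^ (2 * j)
      ∂(volume : Measure (EuclideanSpace ℝ (Fin N))).toSphere =
    sphereArea N * ((ascPochhammer ℝ j).eval (1 / 2) / (ascPochhammer ℝ j).eval ((N : ℝ) / 2)) := by
  have hN : 0 < N := by
    rcases Nat.eq_zero_or_pos N with rfl | h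
    · rw [Subsingleton.elim e 0] at he; simp at he
    · exact h
  have h := integral_sphere_inner_pow e he (2 * j)
  have hc : 0 < (N : ℝ) / 2 := by positivity
  have hg := Real.Gamma_pos_of_pos hc
  have hp := ascPochhammer_pos j _ hc
  rw [integral_pow_mul_exp_neg_sq_even, show ((N : ℝ) + (2 * j : ℕ)) / 2 = (N : ℝ) / 2 + j by
    push_cast; ring, Gamma_add_nat_eq_ascPochhammer hc,
    Gamma_add_nat_eq_ascPochhammer (by norm_num), Real.Gamma_one_half_eq, Real.sqrt_eq_rpow,
    mul_assoc _ (Real.pi ^ _), ← Real.rpow_add Real.pi_pos,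
    show (1 : ℝ) / 2 + (N - 1) / 2 = N / 2 by ring] at h
  rw [sphereArea]
  field_simp
  field_simp at h
  linarith

/-- The spherical integral of a power of the distance is a hypergeometric function. With
`z = 2ρ / (1 + ρ²)` one has `|e - ρ w|² = (1 + ρ²)(1 - z ⟪e, w⟫)`; the binomial series in
`z ⟪e, w⟫` is integrated term by term, and the quadratic transformation sums the result. -/
lemma integral_sphere_norm_sub_rpow (e : EuclideanSpace ℝ (Fin N)) (he : ‖e‖ = 1) {q ρ : ℝ}
    (hq : 0 < q) (h0 : 0 ≤ ρ) (h1 : ρ < 1) :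
    ∫ w : Metric.sphere (0 : EuclideanSpace ℝ (Fin N)) 1,
      ‖e - ρ • (w : EuclideanSpace ℝ (Fin N))‖ ^ (-((N : ℝ) + q))
      ∂(volume : Measure (EuclideanSpace ℝ (Fin N))).toSphere =
    sphereArea N *
      ordinaryHypergeometric (((N : ℝ) + q) / 2) ((q + 2) / 2) ((N : ℝ) / 2) (ρ ^ 2) := by
  have hN : 0 < N := by
    rcases Nat.eq_zero_or_pos N with rfl | h
    · rw [Subsingleton.elim e 0] at he; simp at he
    · exact h
  set a : ℝ := ((N : ℝ) + q) / 2 with ha_def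
  set c : ℝ := (N : ℝ) / 2 with hc_def
  have hc : 0 < c := by positivity
  have ha : 0 < a := by positivity
  set z : ℝ := 2 * ρ / (1 + ρ ^ 2) with hz_def
  have hd : 0 < 1 + ρ ^ 2 := by positivity
  have hz0 : 0 ≤ z := by positivity
  have hz1 : z < 1 := by rw [hz_def, div_lt_one hd]; nlinarith [sq_nonneg (1 - ρ)]
  set σ := (volume : Measure (EuclideanSpace ℝ (Fin N))).toSphere with hσ
  have ht : ∀ w : Metric.sphere (0 : EuclideanSpace ℝ (Fin N)) 1,
      |inner ℝ e (w : EuclideanSpace ℝ (Fin N))| ≤ 1 := by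
    intro w
    have := abs_real_inner_le_norm e (w : EuclideanSpace ℝ (Fin N))
    simpa [he] using this
  have hzt : ∀ w : Metric.sphere (0 : EuclideanSpace ℝ (Fin N)) 1,
      |z * inner ℝ e (w : EuclideanSpace ℝ (Fin N))| < 1 := by
    intro w
    rw [abs_mul, abs_of_nonneg hz0]
    nlinarith [ht w, abs_nonneg (inner ℝ e (w : EuclideanSpace ℝ (Fin N)))]
  have hpt : ∀ w : Metric.sphere (0 : EuclideanSpace ℝ (Fin N)) 1,
      ‖e - ρ • (w : EuclideanSpace ℝ (Fin N))‖ ^ (-((N : ℝ) + q)) = (1 + ρ ^ 2) ^ (-a) *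
        ∑' k : ℕ, (ascPochhammer ℝ k).eval a / k.factorial *
          (z * inner ℝ e (w : EuclideanSpace ℝ (Fin N))) ^ k := by
    intro w
    rw [(hasSum_one_sub_rpow_neg a (hzt w)).tsum_eq, ← Real.mul_rpow hd.le
      (by linarith [(abs_lt.1 (hzt w)).2])]
    have hsq : ‖e - ρ • (w : EuclideanSpace ℝ (Fin N))‖ ^ 2 =
        (1 + ρ ^ 2) * (1 - z * inner ℝ e (w : EuclideanSpace ℝ (Fin N))) := by
      rw [norm_sub_sq_real, inner_smul_right, norm_smul, he, hz_def]
      simp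
      field_simp
      ring
    rw [← hsq, ← Real.rpow_natCast, ← Real.rpow_mul (norm_nonneg _)]
    congr 1
    rw [ha_def]; push_cast; ring
  simp_rw [hpt]
  rw [integral_const_mul]
  have hcont : Continuous fun w : Metric.sphere (0 : EuclideanSpace ℝ (Fin N)) 1 =>
      inner ℝ e (w : EuclideanSpace ℝ (Fin N)) := by fun_prop
  have hint : ∀ k : ℕ, Integrable (fun w : Metric.sphere (0 : EuclideanSpace ℝ (Fin N)) 1 =>
      (ascPochhammer ℝ k).eval a / k.factorial *
          (z * inner ℝ e (w : EuclideanSpace ℝ (Fin N))) ^ k) σ := by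
    intro k
    refine (Continuous.integrable_of_hasCompactSupport (by fun_prop)
      (HasCompactSupport.of_compactSpace _))
  have hbound : ∀ (k : ℕ) (w : Metric.sphere (0 : EuclideanSpace ℝ (Fin N)) 1),
      ‖(ascPochhammer ℝ k).eval a / k.factorial *
        (z * inner ℝ e (w : EuclideanSpace ℝ (Fin N))) ^ k‖ ≤
      (ascPochhammer ℝ k).eval a / k.factorial * z ^ k := by
    intro k w
    have := ascPochhammer_pos k a ha
    rw [norm_mul, norm_pow, Real.norm_eq_abs, abs_of_nonneg (by positivity), norm_mul,
      Real.norm_eq_abs, Real.norm_eq_abs, abs_of_nonneg hz0]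
    gcongr
    exact mul_le_of_le_one_right hz0 (ht w)
  have hsum := hasSum_integral_of_summable_integral_norm hint (by
    refine Summable.of_nonneg_of_le (fun k => integral_nonneg fun _ => norm_nonneg _) (fun k => ?_)
      (((hasSum_one_sub_rpow_neg a (x := z) (by rwa [abs_of_nonneg hz0])).summable).mul_left
        (σ.real univ))
    calc _ ≤ ∫ _, (ascPochhammer ℝ k).eval a / k.factorial * z ^ k ∂σ :=
          integral_mono (hint k).norm (integrable_const _) (hbound k)
      _ = _ := by rw [integral_const, smul_eq_mul])
  have hq2 := (hasSum_quadratic (a := a) (c := c) (x := ρ ^ 2) ha hc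
    (by rw [ha_def, hc_def]; linarith) (by positivity) (by nlinarith)).mul_left (sphereArea N)
  rw [show a + 1 - c = (q + 2) / 2 by rw [ha_def, hc_def]; ring] at hq2
  refine HasSum.unique ?_ hq2
  have hsum' := hsum.mul_left ((1 + ρ ^ 2) ^ (-a))
  rw [← (mul_right_injective₀ (two_ne_zero : (2 : ℕ) ≠ 0)).hasSum_iff] at hsum'
  · refine hsum'.congr_fun fun j => ?_
    simp only [Function.comp_apply]
    simp_rw [mul_pow, ← mul_assoc]
    rw [integral_const_mul, integral_sphere_inner_pow_even e he, ← hc_def, neg_add,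
      Real.rpow_add hd,
      Real.rpow_neg hd.le (_ : ℕ), Real.rpow_natCast]
    have hf : ((2 * j).factorial : ℝ) = 4 ^ j * (ascPochhammer ℝ j).eval (1 / 2) * j.factorial := by
      have := ascPochhammer_eval_two_mul 1 j
      rw [ascPochhammer_eval_one] at this
      rw [this, show ((1 : ℝ) + 1) / 2 = 1 by norm_num, ascPochhammer_eval_one]
    have hp1 := (ascPochhammer_pos j (1 / 2 : ℝ) (by norm_num)).ne'
    have hp2 := (ascPochhammer_pos j c hc).ne'
    rw [hf, hz_def, div_pow, mul_pow, pow_mul 2, pow_mul ρ]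
    field_simp
    norm_num
  · intro k hk
    have hodd : ¬ Even k := fun ⟨m, hm⟩ => hk ⟨m, by simp [hm, two_mul]⟩
    obtain ⟨j, rfl⟩ := Nat.not_even_iff_odd.1 hodd
    simp_rw [mul_pow, ← mul_assoc]
    rw [integral_const_mul, integral_sphere_inner_pow_odd e he, mul_zero, mul_zero]

end Sphere

/-- The factors `α_N` and `B((N-1)/2, 1/2)` combine to the area of the sphere. -/
lemma const_mul_hyperG {N : ℕ} (hN : 2 ≤ N) (q t : ℝ) :
    4 * Real.pi * alphaN N * hyperG N q t = 2 * (sphereArea N *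
      ordinaryHypergeometric (((N : ℝ) + q) / 2) ((q + 2) / 2) ((N : ℝ) / 2) t) := by
  have hN' : (2 : ℝ) ≤ N := by exact_mod_cast hN
  have h1 : 0 < Real.Gamma (((N : ℝ) - 1) / 2) := Real.Gamma_pos_of_pos (by linarith)
  have h2 : 0 < Real.Gamma ((N : ℝ) / 2) := Real.Gamma_pos_of_pos (by linarith)
  have h3 : Real.pi * Real.pi ^ (((N : ℝ) - 3) / 2) * Real.pi ^ ((1 : ℝ) / 2) =
      Real.pi ^ ((N : ℝ) / 2) := by
    nth_rewrite 1 [← Real.rpow_one Real.pi]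
    rw [← Real.rpow_add Real.pi_pos, ← Real.rpow_add Real.pi_pos]
    congr 1; ring
  rw [alphaN, hyperG, ProbabilityTheory.beta, sphereArea, Real.Gamma_one_half_eq,
    Real.sqrt_eq_rpow, show ((N : ℝ) - 1) / 2 + 1 / 2 = N / 2 by ring, ← h3]
  field_simp
  ring

/-! ### The map `Ψ_p` -/

lemma abs_psiP {p : ℝ} (hp : 1 < p) (t : ℝ) : |psiP p t| = |t| ^ (p - 1) := by
  rcases eq_or_ne t 0 with rfl | ht
  · simp [psiP, Real.zero_rpow (by linarith : p - 1 ≠ 0)]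
  · have h := abs_pos.2 ht
    rw [psiP, abs_mul, abs_of_nonneg (by positivity : 0 ≤ |t| ^ (p - 2))]
    nth_rewrite 2 [← Real.rpow_one |t|]
    rw [← Real.rpow_add h]; congr 1; ring

lemma psiP_neg (p t : ℝ) : psiP p (-t) = -psiP p t := by simp [psiP]

lemma psiP_zero (p : ℝ) : psiP p 0 = 0 := by simp [psiP]

lemma psiP_mul {p c : ℝ} (hc : 0 < c) (t : ℝ) : psiP p (c * t) = c ^ (p - 1) * psiP p t := by
  rw [psiP, psiP, abs_mul, abs_of_pos hc, Real.mul_rpow hc.le (abs_nonneg t),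
    show p - 1 = (p - 2) + 1 by ring, Real.rpow_add hc, Real.rpow_one]
  ring

@[fun_prop]
lemma measurable_psiP (p : ℝ) : Measurable (psiP p) := by
  unfold psiP; fun_prop

lemma abs_psiP_sub_le {p : ℝ} (hp : 1 < p) (a b : ℝ) :
    |psiP p (a - b)| ≤ 2 ^ (p - 1) * (|a| ^ (p - 1) + |b| ^ (p - 1)) := by
  have hp' : 0 ≤ p - 1 := by linarith
  rw [abs_psiP hp]
  have h1 : |a - b| ≤ 2 * max |a| |b| := by
    have := abs_sub a b
    linarith [le_max_left |a| |b|, le_max_right |a| |b|]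
  have hm : 0 ≤ max |a| |b| := le_max_of_le_left (abs_nonneg a)
  calc |a - b| ^ (p - 1) ≤ (2 * max |a| |b|) ^ (p - 1) :=
        Real.rpow_le_rpow (abs_nonneg _) h1 hp'
    _ = 2 ^ (p - 1) * (max |a| |b|) ^ (p - 1) := Real.mul_rpow two_pos.le hm
    _ ≤ _ := by
      gcongr
      have ha := Real.rpow_nonneg (abs_nonneg a) (p - 1)
      have hb := Real.rpow_nonneg (abs_nonneg b) (p - 1)
      rcases max_choice |a| |b| with h | h <;> rw [h] <;> linarith

/-! ### Radial profiles -/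

/-- A profile `g` on `(0, ∞)` whose increments are homogeneous of degree `β`. The powers `r ^ β`
have this property, and so does the logarithm, with `β = 0`. -/
structure IsHomogeneousProfile (g : ℝ → ℝ) (β : ℝ) : Prop where
  sub_mul : ∀ R ρ : ℝ, 0 < R → 0 < ρ → g R - g (R * ρ) = R ^ β * (g 1 - g ρ)
  contDiffOn : ContDiffOn ℝ 1 g (Ioi 0)
  measurable : Measurable g

lemma isHomogeneousProfile_rpow (β : ℝ) : IsHomogeneousProfile (fun r => r ^ β) β where
  sub_mul R ρ hR hρ := by
    simp only [Real.one_rpow]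
    rw [Real.mul_rpow hR.le hρ.le]; ring
  contDiffOn := fun x hx =>
    (Real.contDiffAt_rpow_const_of_ne (ne_of_gt hx)).contDiffWithinAt
  measurable := by fun_prop

lemma isHomogeneousProfile_log : IsHomogeneousProfile Real.log 0 where
  sub_mul R ρ hR hρ := by
    rw [Real.log_mul hR.ne' hρ.ne']; simp
  contDiffOn := fun x hx => (Real.contDiffAt_log.2 (ne_of_gt hx)).contDiffWithinAt
  measurable := Real.measurable_log

lemma exists_lipschitz_Icc {g : ℝ → ℝ} (hg : ContDiffOn ℝ 1 g (Ioi 0)) {a : ℝ} (ha : 0 < a)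
    (b : ℝ) : ∃ L : ℝ, 0 ≤ L ∧ ∀ r ∈ Icc a b, ∀ t ∈ Icc a b, |g r - g t| ≤ L * |r - t| := by
  obtain ⟨K, hK⟩ := (hg.mono (fun x hx => lt_of_lt_of_le ha hx.1 : Icc a b ⊆ Ioi 0)
    ).exists_lipschitzOnWith one_ne_zero (convex_Icc a b) isCompact_Icc
  refine ⟨K, K.2, fun r hr t ht => ?_⟩
  simpa [Real.dist_eq] using hK.dist_le_mul r hr t ht

lemma exists_bound_Icc {g : ℝ → ℝ} (hg : ContDiffOn ℝ 1 g (Ioi 0)) {a : ℝ} (ha : 0 < a)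
    (b : ℝ) : ∃ C : ℝ, 0 ≤ C ∧ ∀ r ∈ Icc a b, |g r| ≤ C := by
  have hc : ContinuousOn g (Icc a b) :=
    hg.continuousOn.mono fun x hx => lt_of_lt_of_le ha hx.1
  obtain ⟨C, hC⟩ := isCompact_Icc.exists_bound_of_continuousOn hc
  refine ⟨|C|, abs_nonneg _, fun r hr => (hC r hr).trans (le_abs_self C)⟩

/-! ### Integrability of the truncated and of the full form -/

section Integrability

variable {N : ℕ}

/-- The pairs whose moduli differ by a factor of at least `δ⁻¹`. Truncating to this set removes the
singularity on the diagonal, and is compatible with the symmetry and the scaling of the form. -/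
def ratioSet (N : ℕ) (δ : ℝ) : Set (EuclideanSpace ℝ (Fin N) × EuclideanSpace ℝ (Fin N)) :=
  {z | ‖z.1‖ ≤ δ * ‖z.2‖ ∨ ‖z.2‖ ≤ δ * ‖z.1‖}

lemma measurableSet_ratioSet (δ : ℝ) : MeasurableSet (ratioSet N δ) := by
  have h (z : EuclideanSpace ℝ (Fin N) × EuclideanSpace ℝ (Fin N) → ℝ) (hz : Measurable z)
      (w : EuclideanSpace ℝ (Fin N) × EuclideanSpace ℝ (Fin N) → ℝ) (hw : Measurable w) :
      MeasurableSet {x | z x ≤ δ * w x} := measurableSet_le hz (by fun_prop)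
  exact (h (fun z => ‖z.1‖) (by fun_prop) (fun z => ‖z.2‖) (by fun_prop)).union
    (h (fun z => ‖z.2‖) (by fun_prop) (fun z => ‖z.1‖) (by fun_prop))

lemma one_add_norm_le_of_mem_ratioSet {δ a : ℝ} (hδ1 : δ < 1) (ha : 0 < a)
    {x y : EuclideanSpace ℝ (Fin N)} (hx : a ≤ ‖x‖) (h : (x, y) ∈ ratioSet N δ) :
    (1 - δ) / (1 + 1 / a) * (1 + ‖y‖) ≤ ‖x - y‖ := by
  have h1 : (1 - δ) * max ‖x‖ ‖y‖ ≤ ‖x - y‖ := by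
    have h2 := norm_sub_norm_le x y
    have h3 := norm_sub_norm_le y x
    rw [norm_sub_rev] at h3
    have hx0 := norm_nonneg x
    have hy0 := norm_nonneg y
    rcases h with h | h <;> simp only at h
    · have : ‖x‖ ≤ ‖y‖ := by nlinarith
      rw [max_eq_right this]; linarith
    · have : ‖y‖ ≤ ‖x‖ := by nlinarith
      rw [max_eq_left this]; linarith
  have h2 : 1 + ‖y‖ ≤ (1 + 1 / a) * max ‖x‖ ‖y‖ := by
    have : 1 ≤ 1 / a * max ‖x‖ ‖y‖ := by
      rw [one_div, inv_mul_eq_div, le_div_iff₀ ha, one_mul]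
      exact hx.trans (le_max_left _ _)
    linarith [le_max_right ‖x‖ ‖y‖]
  have h3 : 0 < 1 + 1 / a := by positivity
  rw [div_mul_eq_mul_div, div_le_iff₀ h3]
  nlinarith

lemma exists_bound_of_mem_ratioSet {p δ a m : ℝ} (hp : 1 < p) (hδ1 : δ < 1)
    (ha : 0 < a) (hm : 0 < m) :
    ∃ C : ℝ, 0 ≤ C ∧ ∀ (u : EuclideanSpace ℝ (Fin N) → ℝ) (x y : EuclideanSpace ℝ (Fin N)),
      a ≤ ‖x‖ → (x, y) ∈ ratioSet N δ →
      |psiP p (u x - u y)| * ‖x - y‖ ^ (-m) ≤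
        C * (|u x| ^ (p - 1) * (1 + ‖y‖) ^ (-m) + |u y| ^ (p - 1) / (1 + ‖y‖) ^ m) := by
  set c := (1 - δ) / (1 + 1 / a) with hc_def
  have hc : 0 < c := div_pos (by linarith) (by positivity)
  refine ⟨2 ^ (p - 1) * c ^ (-m), by positivity, fun u x y hx hxy => ?_⟩
  have h1 := one_add_norm_le_of_mem_ratioSet hδ1 ha hx hxy
  have hy : 0 < 1 + ‖y‖ := by positivity
  have h2 : ‖x - y‖ ^ (-m) ≤ c ^ (-m) * (1 + ‖y‖) ^ (-m) := by
    rw [← Real.mul_rpow hc.le hy.le]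
    exact Real.rpow_le_rpow_of_nonpos (by positivity) h1 (by linarith)
  calc _ ≤ 2 ^ (p - 1) * (|u x| ^ (p - 1) + |u y| ^ (p - 1)) *
        (c ^ (-m) * (1 + ‖y‖) ^ (-m)) := by
        gcongr
        exact abs_psiP_sub_le hp _ _
    _ = _ := by
        rw [div_eq_mul_inv, ← Real.rpow_neg hy.le]; ring

lemma integrable_one_add_norm_rpow_neg {q : ℝ} (hq : 0 < q) :
    Integrable fun y : EuclideanSpace ℝ (Fin N) => (1 + ‖y‖) ^ (-((N : ℝ) + q)) :=
  integrable_one_add_norm (by simp; linarith)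

/-- The truncated kernel is integrable in the second variable. -/
lemma integrable_truncated_slice {s p δ : ℝ} (hs : 0 < s) (hp : 1 < p) (hδ1 : δ < 1)
    {u : EuclideanSpace ℝ (Fin N) → ℝ} (hu : Measurable u) (ht : MemTailSpace s p u)
    {x : EuclideanSpace ℝ (Fin N)} (hx : x ≠ 0) :
    Integrable fun y => (ratioSet N δ).indicator
      (fun z => psiP p (u z.1 - u z.2) * ‖z.1 - z.2‖ ^ (-((N : ℝ) + s * p))) (x, y) := by
  have hq : 0 < s * p := by positivity
  obtain ⟨C, hC0, hC⟩ := exists_bound_of_mem_ratioSet (N := N) hp hδ1 (norm_pos_iff.2 hx)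
    (by positivity : 0 < (N : ℝ) + s * p)
  have hb := ((integrable_one_add_norm_rpow_neg (N := N) hq).const_mul (|u x| ^ (p - 1))).add
    ht.2.2 |>.const_mul C
  refine hb.mono' ?_ (Filter.Eventually.of_forall fun y => ?_)
  · refine Measurable.aestronglyMeasurable ?_
    refine Measurable.comp (Measurable.indicator ?_ (measurableSet_ratioSet δ)) (by fun_prop)
    fun_prop
  · by_cases hxy : (x, y) ∈ ratioSet N δ
    · rw [indicator_of_mem hxy, norm_mul, Real.norm_eq_abs, Real.norm_eq_abs,
        abs_of_nonneg (by positivity : 0 ≤ ‖x - y‖ ^ (-((N : ℝ) + s * p)))]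
      exact hC u x y le_rfl hxy
    · rw [indicator_of_notMem hxy, norm_zero]
      simp only [Pi.add_apply]
      positivity

/-- The truncated form, with the test function evaluated at the first variable only. -/
lemma integrable_truncated {s p δ a b : ℝ} (hs : 0 < s) (hp : 1 < p) (hδ1 : δ < 1) (ha : 0 < a)
    {g : ℝ → ℝ} {β : ℝ} (hg : IsHomogeneousProfile g β)
    (ht : MemTailSpace s p fun x : EuclideanSpace ℝ (Fin N) => g ‖x‖)
    {φ : EuclideanSpace ℝ (Fin N) → ℝ} (hφ : Continuous φ) (hφc : HasCompactSupport φ)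
    (hφs : ∀ x, φ x ≠ 0 → ‖x‖ ∈ Icc a b) :
    Integrable ((ratioSet N δ).indicator fun z =>
      psiP p (g ‖z.1‖ - g ‖z.2‖) * ‖z.1 - z.2‖ ^ (-((N : ℝ) + s * p)) * φ z.1) := by
  have hq : 0 < s * p := by positivity
  have hgm := hg.measurable
  obtain ⟨C, hC0, hC⟩ := exists_bound_of_mem_ratioSet (N := N) hp hδ1 ha
    (by positivity : 0 < (N : ℝ) + s * p)
  obtain ⟨G, hG0, hG⟩ := exists_bound_Icc hg.contDiffOn ha b
  have hφi := hφ.integrable_of_hasCompactSupport hφc (μ := volume)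
  have hb := hφi.norm.mul_prod ((((integrable_one_add_norm_rpow_neg (N := N) hq).const_mul
    (G ^ (p - 1))).add ht.2.2).const_mul C)
  refine hb.mono' ?_ (Filter.Eventually.of_forall fun z => ?_)
  · refine Measurable.aestronglyMeasurable (Measurable.indicator ?_ (measurableSet_ratioSet δ))
    fun_prop
  · obtain ⟨x, y⟩ := z
    have hnn : 0 ≤ ‖φ x‖ * (C * (G ^ (p - 1) * (1 + ‖y‖) ^ (-((N : ℝ) + s * p)) +
        |g ‖y‖| ^ (p - 1) / (1 + ‖y‖) ^ ((N : ℝ) + s * p))) := by positivity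
    by_cases hxy : (x, y) ∈ ratioSet N δ
    · rw [indicator_of_mem hxy]
      rcases eq_or_ne (φ x) 0 with h0 | h0
      · simp [h0]
      · have hxab := hφs x h0
        rw [norm_mul, norm_mul, Real.norm_eq_abs (psiP _ _), Real.norm_eq_abs (_ ^ _),
          abs_of_nonneg (by positivity : 0 ≤ ‖x - y‖ ^ (-((N : ℝ) + s * p))), mul_comm]
        refine mul_le_mul_of_nonneg_left ((hC (fun x => g ‖x‖) x y hxab.1 hxy).trans ?_)
          (norm_nonneg _)
        simp only [Pi.add_apply]
        gcongr
        exact hG _ hxab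
    · rw [indicator_of_notMem hxy, norm_zero]
      exact hnn

lemma integrable_indicator_norm_rpow [Nontrivial (EuclideanSpace ℝ (Fin N))] {γ : ℝ} (hγ : 0 < γ)
    (b : ℝ) : Integrable fun z : EuclideanSpace ℝ (Fin N) =>
      (Metric.ball (0 : EuclideanSpace ℝ (Fin N)) b).indicator (fun z => ‖z‖ ^ (γ - N)) z := by
  have hN : 0 < N := by
    have := Module.finrank_pos (R := ℝ) (M := EuclideanSpace ℝ (Fin N)); simpa using this
  rw [integrable_indicator_iff Metric.isOpen_ball.measurableSet]
  refine (integrableOn_fun_norm_addHaar (f := fun r : ℝ => r ^ (γ - N)) volume).2 ?_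
  have h : IntegrableOn (fun r : ℝ => r ^ (γ - 1)) (Ioo 0 b) := by
    rcases le_or_gt b 0 with hb | hb
    · simp [Ioo_eq_empty_of_le hb]
    · exact (intervalIntegral.integrableOn_Ioo_rpow_iff hb).2 (by linarith)
  refine h.congr_fun (fun r hr => ?_) measurableSet_Ioo
  have hr0 : 0 < r := hr.1
  simp only [finrank_euclideanSpace, Fintype.card_fin, smul_eq_mul]
  rw [← Real.rpow_natCast, ← Real.rpow_add hr0, Nat.cast_sub hN]
  congr 1; push_cast; ring

lemma integrable_near_diagonal [Nontrivial (EuclideanSpace ℝ (Fin N))] {γ : ℝ} (hγ : 0 < γ)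
    (b : ℝ) : Integrable
      ((Metric.ball (0 : EuclideanSpace ℝ (Fin N)) b ×ˢ Metric.ball 0 b).indicator
        fun z : EuclideanSpace ℝ (Fin N) × EuclideanSpace ℝ (Fin N) => ‖z.1 - z.2‖ ^ (γ - N)) := by
  have h1 : Integrable fun y : EuclideanSpace ℝ (Fin N) =>
      (Metric.ball (0 : EuclideanSpace ℝ (Fin N)) b).indicator (fun _ => (1 : ℝ)) y := by
    rw [integrable_indicator_iff Metric.isOpen_ball.measurableSet]
    exact integrableOn_const (measure_ball_lt_top.ne)
  have h2 := h1.convolution_integrand (ContinuousLinearMap.mul ℝ ℝ)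
    (integrable_indicator_norm_rpow (N := N) hγ (2 * b))
  refine h2.mono ?_ (Filter.Eventually.of_forall fun z => ?_)
  · refine Measurable.aestronglyMeasurable (Measurable.indicator ?_
      (Metric.isOpen_ball.measurableSet.prod Metric.isOpen_ball.measurableSet))
    fun_prop
  · by_cases hz : z ∈ Metric.ball (0 : EuclideanSpace ℝ (Fin N)) b ×ˢ Metric.ball 0 b
    · have hz1 : ‖z.1‖ < b := by simpa using hz.1
      have hz2 : ‖z.2‖ < b := by simpa using hz.2
      have hz3 : z.1 - z.2 ∈ Metric.ball (0 : EuclideanSpace ℝ (Fin N)) (2 * b) := by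
        rw [mem_ball_zero_iff]; linarith [norm_sub_le z.1 z.2]
      rw [indicator_of_mem hz, indicator_of_mem hz.2, indicator_of_mem hz3]
      simp
    · rw [indicator_of_notMem hz, norm_zero]; exact norm_nonneg _

end Integrability

section FullForm

variable {N : ℕ}

/-- Absolute convergence of the weak form. Off the set where the moduli are comparable it splits
into two truncated forms; on that set both factors of the integrand are Lipschitz. -/
lemma integrable_fullForm [Nontrivial (EuclideanSpace ℝ (Fin N))] {s p a b : ℝ} (hs : 0 < s)
    (hs1 : s < 1) (hp : 1 < p) (ha : 0 < a) {g : ℝ → ℝ} {β : ℝ} (hg : IsHomogeneousProfile g β)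
    (ht : MemTailSpace s p fun x : EuclideanSpace ℝ (Fin N) => g ‖x‖)
    {φ : EuclideanSpace ℝ (Fin N) → ℝ} (hφ : ContDiff ℝ ∞ φ) (hφc : HasCompactSupport φ)
    (hφs : ∀ x, φ x ≠ 0 → ‖x‖ ∈ Icc a b) :
    Integrable fun z : EuclideanSpace ℝ (Fin N) × EuclideanSpace ℝ (Fin N) =>
      psiP p (g ‖z.1‖ - g ‖z.2‖) * ‖z.1 - z.2‖ ^ (-((N : ℝ) + s * p)) * (φ z.1 - φ z.2) := by
  have hgm := hg.measurable
  have hφm : Measurable φ := hφ.continuous.measurable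
  have hγ : 0 < p - s * p := by nlinarith
  obtain ⟨L, hL0, hL⟩ := exists_lipschitz_Icc hg.contDiffOn (half_pos ha) (2 * b)
  obtain ⟨K, hK⟩ := (hφ.of_le (by simp) : ContDiff ℝ 1 φ).lipschitzWith_of_hasCompactSupport hφc
    one_ne_zero
  have hT := integrable_truncated (N := N) (δ := 1 / 2) (b := b) hs hp (by norm_num) ha hg ht
    hφ.continuous hφc hφs
  have hD := (integrable_near_diagonal (N := N) hγ (2 * b + 1)).const_mul (L ^ (p - 1) * K)
  refine ((hT.norm.add hT.swap.norm).add hD).mono' ?_ (Filter.Eventually.of_forall fun z => ?_)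
  · refine Measurable.aestronglyMeasurable ?_
    fun_prop
  obtain ⟨x, y⟩ := z
  have hDn : 0 ≤ L ^ (p - 1) * K * (Metric.ball (0 : EuclideanSpace ℝ (Fin N)) (2 * b + 1) ×ˢ
      Metric.ball 0 (2 * b + 1)).indicator (fun z : EuclideanSpace ℝ (Fin N) ×
        EuclideanSpace ℝ (Fin N) => ‖z.1 - z.2‖ ^ (p - s * p - N)) (x, y) :=
    mul_nonneg (by positivity) (indicator_nonneg (fun z _ => by positivity) _)
  simp only [Pi.add_apply, Function.comp_apply, Prod.swap_prod_mk]
  by_cases hxy : (x, y) ∈ ratioSet N (1 / 2)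
  · have hyx : (y, x) ∈ ratioSet N (1 / 2) := hxy.symm
    rw [indicator_of_mem hxy, indicator_of_mem hyx]
    refine le_add_of_le_of_nonneg ?_ hDn
    refine le_trans (le_of_eq ?_) (norm_add_le _ _)
    congr 1
    simp only
    rw [norm_sub_rev y x, ← neg_sub (g ‖x‖), psiP_neg]
    ring
  · rw [indicator_of_notMem hxy, indicator_of_notMem (fun h => hxy h.symm)]
    simp only [norm_zero, zero_add]
    by_cases h0 : φ x = 0 ∧ φ y = 0
    · rw [h0.1, h0.2]; simpa using hDn
    rcases eq_or_ne x y with rfl | hne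
    · simpa using hDn
    simp only [ratioSet, mem_ofPred_eq, not_or, not_le] at hxy
    have hab : ‖x‖ ∈ Icc (a / 2) (2 * b) ∧ ‖y‖ ∈ Icc (a / 2) (2 * b) := by
      have hx0 := norm_nonneg x
      have hy0 := norm_nonneg y
      rw [not_and_or] at h0
      rcases h0 with h | h
      · have h1 := hφs x h
        refine ⟨⟨?_, ?_⟩, ⟨?_, ?_⟩⟩ <;> linarith [h1.1, h1.2]
      · have h1 := hφs y h
        refine ⟨⟨?_, ?_⟩, ⟨?_, ?_⟩⟩ <;> linarith [h1.1, h1.2]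
    have hd : 0 < ‖x - y‖ := norm_pos_iff.2 (sub_ne_zero.2 hne)
    rw [indicator_of_mem (by
      constructor
      · simp only [mem_ball_zero_iff]; linarith [hab.1.2]
      · simp only [mem_ball_zero_iff]; linarith [hab.2.2])]
    rw [norm_mul, norm_mul, Real.norm_eq_abs (psiP _ _), Real.norm_eq_abs (_ ^ _), abs_psiP hp,
      abs_of_nonneg (by positivity : 0 ≤ ‖x - y‖ ^ (-((N : ℝ) + s * p)))]
    have h1 : |g ‖x‖ - g ‖y‖| ≤ L * ‖x - y‖ :=
      (hL _ hab.1 _ hab.2).trans (mul_le_mul_of_nonneg_left (abs_norm_sub_norm_le x y) hL0)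
    have h2 : ‖φ x - φ y‖ ≤ K * ‖x - y‖ := by
      have := hK.dist_le_mul x y
      rwa [dist_eq_norm, dist_eq_norm] at this
    calc _ ≤ (L * ‖x - y‖) ^ (p - 1) * ‖x - y‖ ^ (-((N : ℝ) + s * p)) * (K * ‖x - y‖) := by
          have : 0 ≤ p - 1 := by linarith
          gcongr
      _ = L ^ (p - 1) * K * (‖x - y‖ ^ (p - 1) * ‖x - y‖ ^ (-((N : ℝ) + s * p)) *
            ‖x - y‖ ^ (1 : ℝ)) := by
          rw [Real.mul_rpow hL0 hd.le, Real.rpow_one]; ring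
      _ = _ := by
          rw [← Real.rpow_add hd, ← Real.rpow_add hd]
          congr 2; ring

end FullForm

/-! ### The radial form of the operator -/

/-- The integral over the unit sphere of `|e - ρ w| ^ (-(N + q))`, for a unit vector `e` and
`0 ≤ ρ < 1`. -/
noncomputable def sphereKernel (N : ℕ) (q ρ : ℝ) : ℝ := sphereArea N *
  ordinaryHypergeometric (((N : ℝ) + q) / 2) ((q + 2) / 2) ((N : ℝ) / 2) (ρ ^ 2)

lemma sphereKernel_pos {N : ℕ} (hN : 0 < N) {q ρ : ℝ} (hq : 0 < q) (h0 : 0 ≤ ρ) (h1 : ρ < 1) :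
    0 < sphereKernel N q ρ :=
  mul_pos (sphereArea_pos hN) (ordinaryHypergeometric_pos (by positivity) (by positivity)
    (by positivity) (by positivity) (by nlinarith))

lemma continuousOn_sphereKernel {N : ℕ} (hN : 0 < N) {q : ℝ} (hq : 0 < q) :
    ContinuousOn (sphereKernel N q) (Ico 0 1) := by
  intro ρ hρ
  refine (continuousAt_const.mul ?_).continuousWithinAt
  refine ContinuousAt.comp' (g := fun y : ℝ => ordinaryHypergeometric (((N : ℝ) + q) / 2)
    ((q + 2) / 2) ((N : ℝ) / 2) y) (f := fun ρ : ℝ => ρ ^ 2)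
    (analyticAt_ordinaryHypergeometric (by positivity) (by positivity) (by positivity) ?_
      ).continuousAt (by fun_prop)
  rw [abs_of_nonneg (by positivity)]
  nlinarith [hρ.1, hρ.2]

section Slice

variable {N : ℕ}

lemma integral_sphere_of_lt {q : ℝ} (hq : 0 < q) {x : EuclideanSpace ℝ (Fin N)} {r : ℝ}
    (hr : 0 < r) (hrx : r < ‖x‖) :
    ∫ w : Metric.sphere (0 : EuclideanSpace ℝ (Fin N)) 1,
      ‖x - r • (w : EuclideanSpace ℝ (Fin N))‖ ^ (-((N : ℝ) + q))
      ∂(volume : Measure (EuclideanSpace ℝ (Fin N))).toSphere =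
    ‖x‖ ^ (-((N : ℝ) + q)) * sphereKernel N q (r / ‖x‖) := by
  have hx : 0 < ‖x‖ := hr.trans hrx
  rw [sphereKernel, ← integral_sphere_norm_sub_rpow (‖x‖⁻¹ • x) (by simp [norm_smul, hx.ne']) hq
    (by positivity) (by rwa [div_lt_one hx]), ← integral_const_mul]
  refine integral_congr_ae (Filter.Eventually.of_forall fun w => ?_)
  simp only
  rw [← Real.mul_rpow hx.le (norm_nonneg _)]
  congr 1
  rw [show ∀ y : EuclideanSpace ℝ (Fin N), ‖x‖ * ‖y‖ = ‖‖x‖ • y‖ from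
    fun y => by rw [norm_smul, norm_norm], smul_sub, smul_smul, smul_smul, mul_inv_cancel₀ hx.ne',
    one_smul, mul_div_cancel₀ _ hx.ne']

lemma integral_sphere_of_gt {q : ℝ} (hq : 0 < q) {x : EuclideanSpace ℝ (Fin N)} {r : ℝ}
    (hx : 0 < ‖x‖) (hrx : ‖x‖ < r) :
    ∫ w : Metric.sphere (0 : EuclideanSpace ℝ (Fin N)) 1,
      ‖x - r • (w : EuclideanSpace ℝ (Fin N))‖ ^ (-((N : ℝ) + q))
      ∂(volume : Measure (EuclideanSpace ℝ (Fin N))).toSphere =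
    r ^ (-((N : ℝ) + q)) * sphereKernel N q (‖x‖ / r) := by
  have hr : 0 < r := hx.trans hrx
  rw [sphereKernel, ← integral_sphere_norm_sub_rpow (‖x‖⁻¹ • x) (by simp [norm_smul, hx.ne']) hq
    (by positivity) (by rwa [div_lt_one hr]), ← integral_const_mul]
  refine integral_congr_ae (Filter.Eventually.of_forall fun w => ?_)
  simp only
  rw [← Real.mul_rpow hr.le (norm_nonneg _)]
  congr 1
  have hw : ‖(w : EuclideanSpace ℝ (Fin N))‖ = 1 := by simp
  -- Both sides have square `‖x‖ ^ 2 + r ^ 2 - 2 * r * ⟪x, w⟫`.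
  refine (sq_eq_sq₀ (norm_nonneg _) (by positivity)).1 ?_
  rw [mul_pow, norm_sub_sq_real, norm_sub_sq_real, inner_smul_right, inner_smul_right,
    inner_smul_left, norm_smul, norm_smul, norm_smul, hw]
  simp [abs_of_pos hr]
  field_simp
  ring

/-- Integration of a radial function against a power of the distance to `x`, in polar coordinates.
-/
lemma radial_integral [Nontrivial (EuclideanSpace ℝ (Fin N))] {m : ℝ}
    (x : EuclideanSpace ℝ (Fin N)) (h : ℝ → ℝ)
    (hf : Integrable fun y : EuclideanSpace ℝ (Fin N) => h ‖y‖ * ‖x - y‖ ^ m) :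
    IntegrableOn (fun r => r ^ (N - 1) * h r *
      ∫ w : Metric.sphere (0 : EuclideanSpace ℝ (Fin N)) 1,
        ‖x - r • (w : EuclideanSpace ℝ (Fin N))‖ ^ m
        ∂(volume : Measure (EuclideanSpace ℝ (Fin N))).toSphere) (Ioi 0) ∧
    ∫ y, h ‖y‖ * ‖x - y‖ ^ m = ∫ r in Ioi 0, r ^ (N - 1) * h r *
      ∫ w : Metric.sphere (0 : EuclideanSpace ℝ (Fin N)) 1,
        ‖x - r • (w : EuclideanSpace ℝ (Fin N))‖ ^ m
        ∂(volume : Measure (EuclideanSpace ℝ (Fin N))).toSphere := by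
  have h1 := (integrable_polar_iff volume _).1 hf
  rw [integral_polar, integral_prod_symm _ h1]
  have h2 := h1.integral_prod_right
  simp only [finrank_euclideanSpace, Fintype.card_fin] at h2 ⊢
  have key : ∀ r ∈ Ioi (0 : ℝ), ∫ w : Metric.sphere (0 : EuclideanSpace ℝ (Fin N)) 1,
      r ^ (N - 1) * (h ‖r • (w : EuclideanSpace ℝ (Fin N))‖ *
        ‖x - r • (w : EuclideanSpace ℝ (Fin N))‖ ^ m)
        ∂(volume : Measure (EuclideanSpace ℝ (Fin N))).toSphere = r ^ (N - 1) * h r *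
      ∫ w : Metric.sphere (0 : EuclideanSpace ℝ (Fin N)) 1,
        ‖x - r • (w : EuclideanSpace ℝ (Fin N))‖ ^ m
        ∂(volume : Measure (EuclideanSpace ℝ (Fin N))).toSphere := by
    intro r hr
    rw [← integral_const_mul]
    refine integral_congr_ae (Filter.Eventually.of_forall fun w => ?_)
    have : ‖r • (w : EuclideanSpace ℝ (Fin N))‖ = r := by
      simp [norm_smul, abs_of_pos (show 0 < r from hr)]
    simp only [this]; ring
  exact ⟨IntegrableOn.congr_fun h2 key measurableSet_Ioi,
    setIntegral_congr_fun measurableSet_Ioi key⟩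

/-- The density in `ρ = |y| / |x| < 1` of the operator applied to a profile; the second power in the
bracket is the contribution of `|y| / |x| = ρ⁻¹`. -/
noncomputable def profileDensity (N : ℕ) (p q β : ℝ) (g : ℝ → ℝ) (ρ : ℝ) : ℝ :=
  psiP p (g 1 - g ρ) * (ρ ^ ((N : ℝ) - 1) - ρ ^ (q - β * (p - 1) - 1)) * sphereKernel N q ρ

/-- Scaling and the inversion `ρ ↦ ρ⁻¹` turn the truncated operator, evaluated at `x`, into a power
of `|x|` times a constant. -/
lemma truncated_slice_eq [Nontrivial (EuclideanSpace ℝ (Fin N))] {s p δ : ℝ} (hs : 0 < s)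
    (hp : 1 < p) (hδ0 : 0 < δ) (hδ1 : δ < 1) {g : ℝ → ℝ} {β : ℝ} (hg : IsHomogeneousProfile g β)
    (ht : MemTailSpace s p fun x : EuclideanSpace ℝ (Fin N) => g ‖x‖)
    {x : EuclideanSpace ℝ (Fin N)} (hx : x ≠ 0) :
    IntegrableOn (profileDensity N p (s * p) β g) (Ioc 0 δ) ∧
    ∫ y, (ratioSet N δ).indicator
      (fun z => psiP p (g ‖z.1‖ - g ‖z.2‖) * ‖z.1 - z.2‖ ^ (-((N : ℝ) + s * p))) (x, y) =
    ‖x‖ ^ (β * (p - 1) - s * p) * ∫ ρ in Ioc 0 δ, profileDensity N p (s * p) β g ρ := by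
  have hN : 0 < N := by
    have := Module.finrank_pos (R := ℝ) (M := EuclideanSpace ℝ (Fin N)); simpa using this
  have hgm := hg.measurable
  set q := s * p with hq_def
  have hq : 0 < q := by positivity
  set R := ‖x‖ with hR_def
  have hR : 0 < R := norm_pos_iff.2 hx
  have hsl := integrable_truncated_slice (N := N) (u := fun x => g ‖x‖) hs hp hδ1
    (by fun_prop) ht hx
  rw [← hq_def] at hsl
  set H : Set ℝ := {r | R ≤ δ * r ∨ r ≤ δ * R} with hH
  set h : ℝ → ℝ := H.indicator fun r => psiP p (g R - g r) with hh
  have e1 : ∀ y, (ratioSet N δ).indicator (fun z => psiP p (g ‖z.1‖ - g ‖z.2‖) *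
      ‖z.1 - z.2‖ ^ (-((N : ℝ) + q))) (x, y) = h ‖y‖ * ‖x - y‖ ^ (-((N : ℝ) + q)) := by
    intro y
    by_cases hxy : (x, y) ∈ ratioSet N δ
    · have : ‖y‖ ∈ H := hxy
      rw [indicator_of_mem hxy, hh, indicator_of_mem this]
    · have : ‖y‖ ∉ H := hxy
      rw [indicator_of_notMem hxy, hh, indicator_of_notMem this, zero_mul]
  simp_rw [e1] at hsl ⊢
  obtain ⟨hVi, hVe⟩ := radial_integral x h hsl
  rw [hVe]
  set V : ℝ → ℝ := fun r => r ^ (N - 1) * h r *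
      ∫ w : Metric.sphere (0 : EuclideanSpace ℝ (Fin N)) 1,
        ‖x - r • (w : EuclideanSpace ℝ (Fin N))‖ ^ (-((N : ℝ) + q))
        ∂(volume : Measure (EuclideanSpace ℝ (Fin N))).toSphere with hV
  -- `V1` and `V2` are the contributions of `|y| ≤ δ |x|` and of `|x| ≤ δ |y|`.
  set V1 := (Iic (δ * R)).indicator V with hV1
  set V2 := (Ici (R / δ)).indicator V with hV2
  have hV1i : IntegrableOn V1 (Ioi 0) := hVi.indicator measurableSet_Iic
  have hV2i : IntegrableOn V2 (Ioi 0) := hVi.indicator measurableSet_Ici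
  have hlt : δ * R < R / δ := by
    rw [lt_div_iff₀ hδ0]; nlinarith [mul_pos hδ0 hR]
  have hVs : ∀ r, V r = V1 r + V2 r := by
    intro r
    by_cases h1 : r ≤ δ * R
    · rw [hV1, hV2, indicator_of_mem (show r ∈ Iic _ from h1), indicator_of_notMem, add_zero]
      simp only [mem_Ici]; linarith
    · by_cases h2 : R / δ ≤ r
      · rw [hV1, hV2, indicator_of_mem (show r ∈ Ici _ from h2), indicator_of_notMem, zero_add]
        exact h1
      · rw [hV1, hV2, indicator_of_notMem (show r ∉ Iic _ from h1),
          indicator_of_notMem (show r ∉ Ici _ from h2), hV]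
        have : r ∉ H := by
          rintro (h3 | h3)
          · exact h2 (by rw [div_le_iff₀ hδ0]; linarith)
          · exact h1 h3
        simp [hh, indicator_of_notMem this]
  set U1 : ℝ → ℝ := fun ρ => R * V1 (R * ρ) with hU1
  set U2' : ℝ → ℝ := fun t => R * V2 (R * t) with hU2'
  set U2 : ℝ → ℝ := fun ρ => (|(-1 : ℝ)| * ρ ^ ((-1 : ℝ) - 1)) • U2' (ρ ^ (-1 : ℝ)) with hU2
  have hsc : ∀ W : ℝ → ℝ, IntegrableOn W (Ioi 0) →
      IntegrableOn (fun ρ => R * W (R * ρ)) (Ioi 0) ∧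
      ∫ ρ in Ioi 0, R * W (R * ρ) = ∫ r in Ioi 0, W r := by
    intro W hW
    constructor
    · refine Integrable.const_mul ?_ R
      have := (integrableOn_Ioi_comp_mul_left_iff W 0 hR).2 (by rwa [mul_zero])
      exact this
    · rw [integral_const_mul, integral_comp_mul_left_Ioi W 0 hR, mul_zero, smul_eq_mul,
        mul_inv_cancel_left₀ hR.ne']
  obtain ⟨hU1i, hU1e⟩ := hsc V1 hV1i
  obtain ⟨hU2i', hU2e'⟩ := hsc V2 hV2i
  have hU2i : IntegrableOn U2 (Ioi 0) := (integrableOn_Ioi_comp_rpow_iff U2' (by norm_num)).2 hU2i'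
  have hU2e : ∫ ρ in Ioi 0, U2 ρ = ∫ r in Ioi 0, V2 r := by
    rw [← hU2e']; exact integral_comp_rpow_Ioi U2' (by norm_num)
  have hpt : ∀ ρ ∈ Ioi (0 : ℝ), U1 ρ + U2 ρ = R ^ (β * (p - 1) - q) *
      (Iic δ).indicator (profileDensity N p q β g) ρ := by
    intro ρ hρ
    have hρ0 : 0 < ρ := hρ
    have hinv : ρ ^ (-1 : ℝ) = ρ⁻¹ := Real.rpow_neg_one ρ
    simp only [hU1, hU2, hU2', hinv]
    by_cases hρδ : ρ ≤ δ
    · have hm1 : R * ρ ∈ Iic (δ * R) := by rw [mem_Iic, mul_comm]; gcongr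
      have hm2 : R * ρ⁻¹ ∈ Ici (R / δ) := by
        rw [mem_Ici, div_eq_mul_inv]; gcongr
      have hρ1 : ρ < 1 := lt_of_le_of_lt hρδ hδ1
      have hH1 : R * ρ ∈ H := Or.inr hm1
      have hH2 : R * ρ⁻¹ ∈ H := by
        left; rw [← div_le_iff₀' hδ0]; exact hm2
      have hlt1 : R * ρ < R := by nlinarith
      have hlt2 : R < R * ρ⁻¹ := by
        have := (one_lt_inv₀ hρ0).2 hρ1
        nlinarith
      rw [hV1, hV2, indicator_of_mem hm1, indicator_of_mem hm2,
        indicator_of_mem (show ρ ∈ Iic δ from hρδ), hV]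
      simp only
      rw [hh, indicator_of_mem hH1, indicator_of_mem hH2, integral_sphere_of_lt hq (by positivity)
        hlt1, integral_sphere_of_gt hq hR hlt2, ← hR_def, mul_div_cancel_left₀ _ hR.ne',
        show R / (R * ρ⁻¹) = ρ by field_simp, hg.sub_mul R ρ hR hρ0,
        show g R - g (R * ρ⁻¹) = -((R * ρ⁻¹) ^ β * (g 1 - g ρ)) by
          rw [← hg.sub_mul _ ρ (by positivity) hρ0, inv_mul_cancel_right₀ hρ0.ne']; ring,
        psiP_neg, psiP_mul (by positivity), psiP_mul (by positivity),
        ← Real.rpow_mul hR.le, ← Real.rpow_mul (by positivity), profileDensity]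
      have hRρ : 0 < R * ρ⁻¹ := by positivity
      have hcN : ((N - 1 : ℕ) : ℝ) = (N : ℝ) - 1 := by rw [Nat.cast_sub hN]; simp
      -- The total power of `R` and of `ρ` on `|y| = R ρ`.
      have c1 : R * (R * ρ) ^ (N - 1) * R ^ (β * (p - 1)) * R ^ (-((N : ℝ) + q)) =
          R ^ (β * (p - 1) - q) * ρ ^ ((N : ℝ) - 1) := by
        rw [← Real.rpow_natCast, Real.mul_rpow hR.le hρ0.le, hcN]
        nth_rewrite 1 [← Real.rpow_one R]
        rw [← mul_assoc, ← Real.rpow_add hR, mul_right_comm _ (ρ ^ _), mul_right_comm _ (ρ ^ _),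
          ← Real.rpow_add hR, ← Real.rpow_add hR]
        congr 2; ring
      -- The same on `|y| = R ρ⁻¹`, including the Jacobian `ρ ^ (-2)` of the inversion.
      have c2 : ρ ^ ((-1 : ℝ) - 1) * R * (R * ρ⁻¹) ^ (N - 1) * (R * ρ⁻¹) ^ (β * (p - 1)) *
          (R * ρ⁻¹) ^ (-((N : ℝ) + q)) =
          R ^ (β * (p - 1) - q) * ρ ^ (q - β * (p - 1) - 1) := by
        have : ρ ^ ((-1 : ℝ) - 1) * R = (R * ρ⁻¹) ^ (1 : ℝ) * ρ ^ (-1 : ℝ) := by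
          rw [Real.rpow_sub hρ0, Real.rpow_one, Real.rpow_one, hinv]; field_simp
        rw [this, ← Real.rpow_natCast, mul_right_comm _ (ρ ^ _), mul_right_comm _ (ρ ^ _),
          mul_right_comm _ (ρ ^ _), ← Real.rpow_add hRρ, ← Real.rpow_add hRρ, ← Real.rpow_add hRρ,
          hcN, Real.mul_rpow hR.le (by positivity), Real.inv_rpow hρ0.le, ← Real.rpow_neg hρ0.le,
          mul_assoc, ← Real.rpow_add hρ0]
        congr 2 <;> ring
      calc _ = (R * (R * ρ) ^ (N - 1) * R ^ (β * (p - 1)) * R ^ (-((N : ℝ) + q))) *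
              (psiP p (g 1 - g ρ) * sphereKernel N q ρ) -
            (ρ ^ ((-1 : ℝ) - 1) * R * (R * ρ⁻¹) ^ (N - 1) * (R * ρ⁻¹) ^ (β * (p - 1)) *
              (R * ρ⁻¹) ^ (-((N : ℝ) + q))) * (psiP p (g 1 - g ρ) * sphereKernel N q ρ) := by
            simp only [abs_neg, abs_one, one_mul, smul_eq_mul]; ring
        _ = _ := by rw [c1, c2]; ring
    · have hm1 : R * ρ ∉ Iic (δ * R) := by
        rw [mem_Iic, mul_comm, not_le]
        exact mul_lt_mul_of_pos_right (not_le.1 hρδ) hR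
      have hm2 : R * ρ⁻¹ ∉ Ici (R / δ) := by
        rw [mem_Ici, div_eq_mul_inv, not_le]
        exact mul_lt_mul_of_pos_left ((inv_lt_inv₀ hρ0 hδ0).2 (not_le.1 hρδ)) hR
      rw [hV1, hV2, indicator_of_notMem hm1, indicator_of_notMem hm2,
        indicator_of_notMem (show ρ ∉ Iic δ from hρδ)]
      simp
  have hRne : R ^ (β * (p - 1) - q) ≠ 0 := (Real.rpow_pos_of_pos hR _).ne'
  have hset : Ioi (0 : ℝ) ∩ Iic δ = Ioc 0 δ := rfl
  constructor
  · have h3 : IntegrableOn ((Iic δ).indicator (profileDensity N p q β g)) (Ioi 0) := by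
      have := ((hU1i.add hU2i).const_mul (R ^ (β * (p - 1) - q))⁻¹)
      refine IntegrableOn.congr_fun this (fun ρ hρ => ?_) measurableSet_Ioi
      simp only [Pi.add_apply]
      have := hpt ρ hρ
      simp only [hU1] at this
      rw [this, inv_mul_cancel_left₀ hRne]
    rw [IntegrableOn, integrable_indicator_iff measurableSet_Iic, IntegrableOn,
      Measure.restrict_restrict measurableSet_Iic, inter_comm, hset] at h3
    exact h3
  · rw [show (∫ r in Ioi 0, V r) = ∫ r in Ioi 0, (V1 r + V2 r) by simp_rw [hVs],
      integral_add hV1i hV2i, ← hU1e, ← hU2e, ← integral_add hU1i hU2i,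
      setIntegral_congr_fun measurableSet_Ioi hpt, integral_const_mul,
      setIntegral_indicator measurableSet_Iic, hset]

end Slice

/-! ### The weak form of a radial profile -/

section Identity

variable {N : ℕ}

/-- Near `ρ = 1` the density is bounded by `(1 - ρ) ^ p` times the kernel, because the bracket in
its definition vanishes there as well. -/
lemma integrableOn_profileDensity [Nontrivial (EuclideanSpace ℝ (Fin N))] {s p : ℝ} (hs : 0 < s)
    (hs1 : s < 1) (hp : 1 < p) {g : ℝ → ℝ} {β : ℝ} (hg : IsHomogeneousProfile g β)
    (ht : MemTailSpace s p fun x : EuclideanSpace ℝ (Fin N) => g ‖x‖) :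
    IntegrableOn (profileDensity N p (s * p) β g) (Ioo 0 1) := by
  have hN : 0 < N := by
    have := Module.finrank_pos (R := ℝ) (M := EuclideanSpace ℝ (Fin N)); simpa using this
  have hq : 0 < s * p := by positivity
  have hγ : 0 < p - s * p := by nlinarith
  have hp0 : 0 ≤ p - 1 := by linarith
  have hgm := hg.measurable
  obtain ⟨e, he⟩ := exists_norm_eq (EuclideanSpace ℝ (Fin N)) zero_le_one
  have he0 : e ≠ 0 := by rintro rfl; simp at he
  have h1 := (truncated_slice_eq (δ := 1 / 2) hs hp (by norm_num) (by norm_num) hg ht he0).1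
  rw [show Ioo (0 : ℝ) 1 = Ioc 0 (1 / 2) ∪ Ioo (1 / 2) 1 from
    (Ioc_union_Ioo_eq_Ioo (by norm_num) (by norm_num)).symm]
  refine h1.union ?_
  set h : ℝ → ℝ := (Ioo (1 / 2) 1).indicator fun r => (1 - r) ^ p with hh
  have hhm : Measurable h := Measurable.indicator (by fun_prop) measurableSet_Ioo
  have hf : Integrable fun y : EuclideanSpace ℝ (Fin N) =>
      h ‖y‖ * ‖e - y‖ ^ (-((N : ℝ) + s * p)) := by
    have h2 := (integrable_indicator_norm_rpow (N := N) hγ 2).comp_sub_left e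
    refine h2.mono' (by fun_prop) (Filter.Eventually.of_forall fun y => ?_)
    have hnn : 0 ≤ (Metric.ball (0 : EuclideanSpace ℝ (Fin N)) 2).indicator
        (fun z => ‖z‖ ^ (p - s * p - N)) (e - y) := indicator_nonneg (fun z _ => by positivity) _
    by_cases hy : ‖y‖ ∈ Ioo (1 / 2 : ℝ) 1
    · have hmem : e - y ∈ Metric.ball (0 : EuclideanSpace ℝ (Fin N)) 2 := by
        rw [mem_ball_zero_iff]; linarith [norm_sub_le e y, hy.2]
      have hle : 1 - ‖y‖ ≤ ‖e - y‖ := by rw [← he]; exact norm_sub_norm_le e y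
      have hpos : 0 < ‖e - y‖ := by linarith [hy.2]
      have h1y : 0 ≤ 1 - ‖y‖ := by linarith [hy.2]
      rw [hh, indicator_of_mem hy, indicator_of_mem hmem, norm_mul, Real.norm_eq_abs,
        Real.norm_eq_abs, abs_of_nonneg (by positivity), abs_of_nonneg (by positivity)]
      calc _ ≤ ‖e - y‖ ^ p * ‖e - y‖ ^ (-((N : ℝ) + s * p)) := by gcongr
        _ = _ := by rw [← Real.rpow_add hpos]; congr 1; ring
    · rw [hh, indicator_of_notMem hy, zero_mul, norm_zero]; exact hnn
  have h3 := (radial_integral e h hf).1.mono_set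
    (fun r hr => lt_trans (by norm_num) hr.1 : Ioo (1 / 2 : ℝ) 1 ⊆ Ioi 0)
  obtain ⟨L, hL0, hL⟩ := exists_lipschitz_Icc hg.contDiffOn (half_pos one_pos) 1
  obtain ⟨M, hM0, hM⟩ := exists_lipschitz_Icc
    (g := fun ρ : ℝ => ρ ^ ((N : ℝ) - 1) - ρ ^ (s * p - β * (p - 1) - 1))
    (fun x hx => ((Real.contDiffAt_rpow_const_of_ne (ne_of_gt hx)).sub
      (Real.contDiffAt_rpow_const_of_ne (ne_of_gt hx))).contDiffWithinAt) (half_pos one_pos) 1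
  refine Integrable.mono' (h3.const_mul (L ^ (p - 1) * M * 2 ^ (N - 1))) ?_ ?_
  · refine AEStronglyMeasurable.mul (Measurable.aestronglyMeasurable (by fun_prop)) ?_
    exact ((continuousOn_sphereKernel hN hq).mono
      (fun r hr => ⟨by linarith [hr.1], hr.2⟩)).aestronglyMeasurable measurableSet_Ioo
  · filter_upwards [ae_restrict_mem measurableSet_Ioo] with ρ hρ
    have hρ0 : 0 < ρ := by linarith [hρ.1]
    have h1ρ : 0 < 1 - ρ := by linarith [hρ.2]
    have hk := sphereKernel_pos hN hq hρ0.le hρ.2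
    have hρI : ρ ∈ Icc (1 / 2 : ℝ) 1 := ⟨hρ.1.le, hρ.2.le⟩
    rw [integral_sphere_of_lt hq hρ0 (by rw [he]; exact hρ.2), he, Real.one_rpow, div_one, one_mul,
      hh, indicator_of_mem hρ, profileDensity, norm_mul, norm_mul, Real.norm_eq_abs,
      Real.norm_eq_abs, Real.norm_eq_abs, abs_psiP hp, abs_of_pos hk]
    have b1 : |g 1 - g ρ| ≤ L * (1 - ρ) := by
      have := hL 1 ⟨by norm_num, le_rfl⟩ ρ hρI
      rwa [abs_of_pos h1ρ] at this
    have b2 : |ρ ^ ((N : ℝ) - 1) - ρ ^ (s * p - β * (p - 1) - 1)| ≤ M * (1 - ρ) := by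
      have := hM ρ hρI 1 ⟨by norm_num, le_rfl⟩
      rwa [Real.one_rpow, Real.one_rpow, sub_self, sub_zero, abs_sub_comm ρ 1,
        abs_of_pos h1ρ] at this
    have b3 : 1 ≤ 2 ^ (N - 1) * ρ ^ (N - 1) := by
      rw [← mul_pow]; exact one_le_pow₀ (by linarith [hρ.1])
    calc _ ≤ (L * (1 - ρ)) ^ (p - 1) * (M * (1 - ρ)) * sphereKernel N (s * p) ρ := by gcongr
      _ = L ^ (p - 1) * M * ((1 - ρ) ^ (p - 1) * (1 - ρ) ^ (1 : ℝ)) * sphereKernel N (s * p) ρ := by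
          rw [Real.mul_rpow hL0 h1ρ.le, Real.rpow_one]; ring
      _ = L ^ (p - 1) * M * 1 * ((1 - ρ) ^ p * sphereKernel N (s * p) ρ) := by
          rw [← Real.rpow_add h1ρ, sub_add_cancel]; ring
      _ ≤ L ^ (p - 1) * M * (2 ^ (N - 1) * ρ ^ (N - 1)) *
            ((1 - ρ) ^ p * sphereKernel N (s * p) ρ) := by gcongr
      _ = _ := by ring

lemma integral_truncated [Nontrivial (EuclideanSpace ℝ (Fin N))] {s p δ a b : ℝ} (hs : 0 < s)
    (hp : 1 < p) (hδ0 : 0 < δ) (hδ1 : δ < 1) (ha : 0 < a) {g : ℝ → ℝ} {β : ℝ}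
    (hg : IsHomogeneousProfile g β)
    (ht : MemTailSpace s p fun x : EuclideanSpace ℝ (Fin N) => g ‖x‖)
    {φ : EuclideanSpace ℝ (Fin N) → ℝ} (hφ : Continuous φ) (hφc : HasCompactSupport φ)
    (hφs : ∀ x, φ x ≠ 0 → ‖x‖ ∈ Icc a b) :
    ∫ z, (ratioSet N δ).indicator (fun z => psiP p (g ‖z.1‖ - g ‖z.2‖) *
      ‖z.1 - z.2‖ ^ (-((N : ℝ) + s * p)) * (φ z.1 - φ z.2)) z =
    2 * (∫ ρ in Ioc 0 δ, profileDensity N p (s * p) β g ρ) *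
      ∫ x, ‖x‖ ^ (β * (p - 1) - s * p) * φ x := by
  set T := (ratioSet N δ).indicator fun z =>
      psiP p (g ‖z.1‖ - g ‖z.2‖) * ‖z.1 - z.2‖ ^ (-((N : ℝ) + s * p)) * φ z.1 with hTdef
  have hT : Integrable T := integrable_truncated hs hp hδ1 ha hg ht hφ hφc hφs
  have e1 : ∀ z, (ratioSet N δ).indicator (fun z => psiP p (g ‖z.1‖ - g ‖z.2‖) *
      ‖z.1 - z.2‖ ^ (-((N : ℝ) + s * p)) * (φ z.1 - φ z.2)) z = T z + T z.swap := by
    rintro ⟨x, y⟩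
    simp only [Prod.swap_prod_mk]
    by_cases hxy : (x, y) ∈ ratioSet N δ
    · have hyx : (y, x) ∈ ratioSet N δ := hxy.symm
      rw [hTdef, indicator_of_mem hxy, indicator_of_mem hxy, indicator_of_mem hyx]
      simp only
      rw [norm_sub_rev y x, ← neg_sub (g ‖x‖), psiP_neg]
      ring
    · rw [hTdef, indicator_of_notMem hxy, indicator_of_notMem hxy,
        indicator_of_notMem (fun h => hxy h.symm), add_zero]
  have e2 : ∫ z : EuclideanSpace ℝ (Fin N) × EuclideanSpace ℝ (Fin N), T z.swap = ∫ z, T z :=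
    integral_prod_swap T
  have e3 : ∫ z, T z = ∫ x, ∫ y, T (x, y) := integral_prod _ hT
  have e4 : ∀ x, ∫ y, T (x, y) = (∫ ρ in Ioc 0 δ, profileDensity N p (s * p) β g ρ) *
      (‖x‖ ^ (β * (p - 1) - s * p) * φ x) := by
    intro x
    have e5 : ∀ y, T (x, y) = (ratioSet N δ).indicator (fun z => psiP p (g ‖z.1‖ - g ‖z.2‖) *
        ‖z.1 - z.2‖ ^ (-((N : ℝ) + s * p))) (x, y) * φ x := by
      intro y
      by_cases hxy : (x, y) ∈ ratioSet N δ
      · rw [hTdef, indicator_of_mem hxy, indicator_of_mem hxy]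
      · rw [hTdef, indicator_of_notMem hxy, indicator_of_notMem hxy, zero_mul]
    simp_rw [e5]
    rw [integral_mul_const]
    rcases eq_or_ne (φ x) 0 with h0 | h0
    · simp [h0]
    · have hx : x ≠ 0 := norm_pos_iff.1 (ha.trans_le (hφs x h0).1)
      rw [(truncated_slice_eq hs hp hδ0 hδ1 hg ht hx).2]
      ring
  simp_rw [e1]
  have hTs : Integrable fun z : EuclideanSpace ℝ (Fin N) × EuclideanSpace ℝ (Fin N) =>
      T z.swap := hT.swap
  rw [integral_add hT hTs, e2, e3]
  simp_rw [e4]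
  rw [integral_const_mul]
  ring

/-- The weak form of a radial profile. The pairs left out by the truncations in the limit have
`|x| = |y|`, where the integrand vanishes. -/
lemma integral_fullForm [Nontrivial (EuclideanSpace ℝ (Fin N))] {s p a b : ℝ} (hs : 0 < s)
    (hs1 : s < 1) (hp : 1 < p) (ha : 0 < a) {g : ℝ → ℝ} {β : ℝ} (hg : IsHomogeneousProfile g β)
    (ht : MemTailSpace s p fun x : EuclideanSpace ℝ (Fin N) => g ‖x‖)
    {φ : EuclideanSpace ℝ (Fin N) → ℝ} (hφ : ContDiff ℝ ∞ φ) (hφc : HasCompactSupport φ)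
    (hφs : ∀ x, φ x ≠ 0 → ‖x‖ ∈ Icc a b) :
    ∫ z : EuclideanSpace ℝ (Fin N) × EuclideanSpace ℝ (Fin N), psiP p (g ‖z.1‖ - g ‖z.2‖) *
      ‖z.1 - z.2‖ ^ (-((N : ℝ) + s * p)) * (φ z.1 - φ z.2) =
    2 * (∫ ρ in Ioo 0 1, profileDensity N p (s * p) β g ρ) *
      ∫ x, ‖x‖ ^ (β * (p - 1) - s * p) * φ x := by
  have hF := integrable_fullForm hs hs1 hp ha hg ht hφ hφc hφs
  set F := fun z : EuclideanSpace ℝ (Fin N) × EuclideanSpace ℝ (Fin N) =>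
    psiP p (g ‖z.1‖ - g ‖z.2‖) * ‖z.1 - z.2‖ ^ (-((N : ℝ) + s * p)) * (φ z.1 - φ z.2) with hFdef
  set δ : ℕ → ℝ := fun n => 1 - 1 / ((n : ℝ) + 2) with hδ
  have hδ0 : ∀ n, 0 < δ n := fun n => by
    have : 1 / ((n : ℝ) + 2) < 1 := by
      rw [div_lt_one (by positivity)]; linarith [n.cast_nonneg (α := ℝ)]
    simp only [hδ]; linarith
  have hδ1 : ∀ n, δ n < 1 := fun n => by
    have : 0 < 1 / ((n : ℝ) + 2) := by positivity
    simp only [hδ]; linarith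
  have hδm : Monotone δ := by
    intro m n hmn
    have : (m : ℝ) ≤ n := by exact_mod_cast hmn
    simp only [hδ]
    gcongr
  have hδt : Filter.Tendsto δ Filter.atTop (nhds 1) := by
    have h1 : Filter.Tendsto (fun n : ℕ => (n : ℝ) + 2) Filter.atTop Filter.atTop :=
      Filter.tendsto_atTop_add_const_right _ _ tendsto_natCast_atTop_atTop
    have h2 := (tendsto_const_nhds (x := (1 : ℝ))).sub
      ((tendsto_const_nhds (x := (1 : ℝ))).div_atTop h1)
    simpa [hδ] using h2
  have hpt : ∀ z, Filter.Tendsto (fun n => (ratioSet N (δ n)).indicator F z) Filter.atTop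
      (nhds (F z)) := by
    rintro ⟨x, y⟩
    rcases eq_or_ne ‖x‖ ‖y‖ with hxy | hxy
    · have : F (x, y) = 0 := by simp [hFdef, hxy, psiP_zero]
      have h2 : ∀ n, (ratioSet N (δ n)).indicator F (x, y) = 0 := fun n =>
        indicator_apply_eq_zero.2 fun _ => this
      simp_rw [h2, this]
      exact tendsto_const_nhds
    · refine tendsto_const_nhds.congr' ?_
      have hev : ∀ᶠ n in Filter.atTop, (x, y) ∈ ratioSet N (δ n) := by
        rcases lt_or_gt_of_ne hxy with h | h
        · have hy : 0 < ‖y‖ := (norm_nonneg x).trans_lt h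
          filter_upwards [hδt.eventually_const_lt ((div_lt_one hy).2 h)] with n hn
          left
          exact ((div_lt_iff₀ hy).1 hn).le
        · have hx : 0 < ‖x‖ := (norm_nonneg y).trans_lt h
          filter_upwards [hδt.eventually_const_lt ((div_lt_one hx).2 h)] with n hn
          right
          exact ((div_lt_iff₀ hx).1 hn).le
      filter_upwards [hev] with n hn
      rw [indicator_of_mem hn]
  have hlim1 : Filter.Tendsto (fun n => ∫ z, (ratioSet N (δ n)).indicator F z) Filter.atTop
      (nhds (∫ z, F z)) := by
    refine tendsto_integral_of_dominated_convergence (fun z => ‖F z‖)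
      (fun n => hF.aestronglyMeasurable.indicator (measurableSet_ratioSet _)) hF.norm
      (fun n => Filter.Eventually.of_forall fun z => norm_indicator_le_norm_self _ _)
      (Filter.Eventually.of_forall hpt)
  have hU : ⋃ n, Ioc 0 (δ n) = Ioo (0 : ℝ) 1 := by
    ext ρ
    simp only [mem_iUnion, mem_Ioc, mem_Ioo]
    constructor
    · rintro ⟨n, h1, h2⟩; exact ⟨h1, h2.trans_lt (hδ1 n)⟩
    · rintro ⟨h1, h2⟩
      obtain ⟨n, hn⟩ := (hδt.eventually_const_lt h2).exists
      exact ⟨n, h1, hn.le⟩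
  have hlim2 := tendsto_setIntegral_of_monotone (μ := volume)
    (f := profileDensity N p (s * p) β g) (s := fun n => Ioc 0 (δ n))
    (fun n => measurableSet_Ioc) (fun m n hmn => Ioc_subset_Ioc_right (hδm hmn))
    (by rw [hU]; exact integrableOn_profileDensity hs hs1 hp hg ht)
  rw [hU] at hlim2
  have hlim3 := (hlim2.const_mul 2).mul_const (∫ x, ‖x‖ ^ (β * (p - 1) - s * p) * φ x)
  refine tendsto_nhds_unique (hlim1.congr fun n => ?_) hlim3
  exact integral_truncated hs hp (hδ0 n) (hδ1 n) ha hg ht hφ.continuous hφc hφs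

end Identity

/-! ### Weak solutions -/

section WeakSolution

variable {N : ℕ}

lemma exists_norm_mem_Icc {K : Set (EuclideanSpace ℝ (Fin N))} (hK : IsCompact K)
    (h0 : (0 : EuclideanSpace ℝ (Fin N)) ∉ K) : ∃ a b : ℝ, 0 < a ∧ ∀ x ∈ K, ‖x‖ ∈ Icc a b := by
  obtain ⟨b, hb⟩ := hK.isBounded.exists_norm_le
  obtain ⟨a, ha, hab⟩ := Metric.mem_nhds_iff.1 (hK.isClosed.isOpen_compl.mem_nhds h0)
  refine ⟨a, b, ha, fun x hx => ⟨?_, hb x hx⟩⟩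
  by_contra hlt
  exact hab (mem_ball_zero_iff.2 (not_le.1 hlt)) hx

lemma memFracSobolevLoc_profile [Nontrivial (EuclideanSpace ℝ (Fin N))] {s p : ℝ}
    (hs1 : s < 1) (hp : 1 < p) {g : ℝ → ℝ} {β : ℝ} (hg : IsHomogeneousProfile g β)
    {U : Set (EuclideanSpace ℝ (Fin N))} (hU : U ⊆ {0}ᶜ) :
    MemFracSobolevLoc s p U fun x => g ‖x‖ := by
  intro V hVo hVc hVU
  have hgm := hg.measurable
  obtain ⟨a, b, ha, hab⟩ := exists_norm_mem_Icc hVc (fun h => hU (hVU h) rfl)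
  have hab' : ∀ x ∈ V, ‖x‖ ∈ Icc a b := fun x hx => hab x (subset_closure hx)
  have hγ : 0 < p - s * p := by nlinarith
  constructor
  · have : IsFiniteMeasure (volume.restrict V) := ⟨by
      rw [Measure.restrict_apply_univ]
      exact (measure_mono subset_closure).trans_lt hVc.measure_lt_top⟩
    obtain ⟨C, hC0, hC⟩ := exists_bound_Icc hg.contDiffOn ha b
    refine MemLp.of_bound (Measurable.aestronglyMeasurable (by fun_prop)) C ?_
    filter_upwards [ae_restrict_mem hVo.measurableSet] with x hx
    exact hC _ (hab' x hx)
  · obtain ⟨L, hL0, hL⟩ := exists_lipschitz_Icc hg.contDiffOn ha b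
    have hsub : V ×ˢ V ⊆ Metric.ball (0 : EuclideanSpace ℝ (Fin N)) (b + 1) ×ˢ
        Metric.ball 0 (b + 1) := by
      rintro ⟨x, y⟩ ⟨hx, hy⟩
      constructor
      · simp only [mem_ball_zero_iff]; linarith [(hab' x hx).2]
      · simp only [mem_ball_zero_iff]; linarith [(hab' y hy).2]
    have hD := ((integrable_indicator_iff (Metric.isOpen_ball.measurableSet.prod
      Metric.isOpen_ball.measurableSet)).1 (integrable_near_diagonal (N := N) hγ (b + 1))).mono_set
        hsub
    refine Integrable.mono' (hD.const_mul (L ^ p))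
      (Measurable.aestronglyMeasurable (by fun_prop)) ?_
    filter_upwards [ae_restrict_mem (hVo.measurableSet.prod hVo.measurableSet)] with z hz
    obtain ⟨x, y⟩ := z
    rcases eq_or_ne x y with rfl | hne
    · simp only [sub_self, abs_zero, norm_zero]
      rw [Real.zero_rpow (by linarith), zero_div, norm_zero]
      positivity
    have hd : 0 < ‖x - y‖ := norm_pos_iff.2 (sub_ne_zero.2 hne)
    have h1 : |g ‖x‖ - g ‖y‖| ≤ L * ‖x - y‖ :=
      (hL _ (hab' x hz.1) _ (hab' y hz.2)).trans
        (mul_le_mul_of_nonneg_left (abs_norm_sub_norm_le x y) hL0)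
    rw [Real.norm_of_nonneg (by positivity)]
    calc _ ≤ (L * ‖x - y‖) ^ p / ‖x - y‖ ^ ((N : ℝ) + s * p) := by gcongr
      _ = L ^ p * ‖x - y‖ ^ (p - s * p - N) := by
        rw [Real.mul_rpow hL0 hd.le, mul_div_assoc, ← Real.rpow_sub hd]
        congr 2; ring

lemma isWeakSolution_profile [Nontrivial (EuclideanSpace ℝ (Fin N))] {s p : ℝ} (hs : 0 < s)
    (hs1 : s < 1) (hp : 1 < p) {g : ℝ → ℝ} {β : ℝ} (hg : IsHomogeneousProfile g β)
    (ht : MemTailSpace s p fun x : EuclideanSpace ℝ (Fin N) => g ‖x‖) :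
    IsWeakSolution s p ({0}ᶜ : Set (EuclideanSpace ℝ (Fin N)))
      (fun x _ => 2 * (∫ ρ in Ioo 0 1, profileDensity N p (s * p) β g ρ) *
        ‖x‖ ^ (β * (p - 1) - s * p)) (fun x => g ‖x‖) := by
  have key : ∀ (U : Set (EuclideanSpace ℝ (Fin N))) (φ : EuclideanSpace ℝ (Fin N) → ℝ),
      U ⊆ {0}ᶜ → IsNonnegTest U φ →
      Integrable (fracPLaplaceIntegrand s p (fun x => g ‖x‖) φ) volume ∧
      Integrable (fun x => 2 * (∫ ρ in Ioo 0 1, profileDensity N p (s * p) β g ρ) *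
        ‖x‖ ^ (β * (p - 1) - s * p) * φ x) volume ∧
      ∫ z, fracPLaplaceIntegrand s p (fun x => g ‖x‖) φ z =
        ∫ x, 2 * (∫ ρ in Ioo 0 1, profileDensity N p (s * p) β g ρ) *
        ‖x‖ ^ (β * (p - 1) - s * p) * φ x := by
    rintro U φ hU ⟨hφ, hφc, hφU, -⟩
    obtain ⟨a, b, ha, hab⟩ := exists_norm_mem_Icc hφc (fun h => hU (hφU h) rfl)
    have hφs : ∀ x, φ x ≠ 0 → ‖x‖ ∈ Icc a b := fun x hx => hab x (subset_tsupport _ hx)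
    have e : fracPLaplaceIntegrand s p (fun x => g ‖x‖) φ = fun z => psiP p (g ‖z.1‖ - g ‖z.2‖) *
      ‖z.1 - z.2‖ ^ (-((N : ℝ) + s * p)) * (φ z.1 - φ z.2) := by
      ext z
      rw [fracPLaplaceIntegrand, Real.rpow_neg (norm_nonneg _)]
      ring
    rw [e]
    refine ⟨integrable_fullForm hs hs1 hp ha hg ht hφ hφc hφs, ?_, ?_⟩
    · obtain ⟨C, hC0, hC⟩ := exists_bound_Icc
        (isHomogeneousProfile_rpow (β * (p - 1) - s * p)).contDiffOn ha b
      simp_rw [mul_assoc]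
      refine Integrable.const_mul (Integrable.const_mul ?_ _) _
      have hφm : Measurable φ := hφ.continuous.measurable
      refine ((hφ.continuous.integrable_of_hasCompactSupport hφc).norm.const_mul C).mono'
        (Measurable.aestronglyMeasurable (by fun_prop)) (Filter.Eventually.of_forall fun x => ?_)
      rw [norm_mul]
      rcases eq_or_ne (φ x) 0 with h0 | h0
      · simp [h0]
      · gcongr
        exact hC _ (hφs x h0)
    · rw [integral_fullForm hs hs1 hp ha hg ht hφ hφc hφs, ← integral_const_mul]
      simp_rw [mul_assoc]
  refine ⟨⟨ht, fun U _ _ hU => ⟨memFracSobolevLoc_profile hs1 hp hg hU, fun φ hφ => ?_⟩⟩,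
    ⟨ht, fun U _ _ hU => ⟨memFracSobolevLoc_profile hs1 hp hg hU, fun φ hφ => ?_⟩⟩⟩
  · obtain ⟨h1, h2, h3⟩ := key U φ hU hφ
    exact ⟨h1, h2, h3.ge⟩
  · obtain ⟨h1, h2, h3⟩ := key U φ hU hφ
    exact ⟨h1, h2, h3.le⟩

end WeakSolution

/-! ### The tail space -/

section Tail

variable {N : ℕ}

/-- The weighted condition in the tail space implies the local one. -/
lemma memTailSpace_of_integrable {s p : ℝ} {u : EuclideanSpace ℝ (Fin N) → ℝ} (hu : Measurable u)
    (h : Integrable fun x => |u x| ^ (p - 1) / (1 + ‖x‖) ^ ((N : ℝ) + s * p)) :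
    MemTailSpace s p u := by
  refine ⟨hu.aestronglyMeasurable, ?_, h⟩
  have hpos : ∀ x : EuclideanSpace ℝ (Fin N), 0 < 1 + ‖x‖ := fun x => by positivity
  have hc : Continuous fun x : EuclideanSpace ℝ (Fin N) => (1 + ‖x‖) ^ ((N : ℝ) + s * p) :=
    Continuous.rpow_const (by fun_prop) fun x => Or.inl (hpos x).ne'
  rw [locallyIntegrable_iff]
  intro K hK
  refine ((h.integrableOn (s := K)).mul_continuousOn hc.continuousOn hK).congr_fun
    (fun x _ => ?_) hK.measurableSet
  exact div_mul_cancel₀ _ (Real.rpow_pos_of_pos (hpos x) _).ne'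

variable [Nontrivial (EuclideanSpace ℝ (Fin N))]

lemma integrable_norm_rpow_div {α q : ℝ} (h1 : -(N : ℝ) < α) (h2 : α < q) :
    Integrable fun x : EuclideanSpace ℝ (Fin N) => ‖x‖ ^ α / (1 + ‖x‖) ^ ((N : ℝ) + q) := by
  have hN : 0 < N := by
    have := Module.finrank_pos (R := ℝ) (M := EuclideanSpace ℝ (Fin N)); simpa using this
  refine (integrable_fun_norm_addHaar volume
    (f := fun r : ℝ => r ^ α / (1 + r) ^ ((N : ℝ) + q))).2 ?_
  simp only [finrank_euclideanSpace, Fintype.card_fin, smul_eq_mul]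
  have hm : 0 ≤ (N : ℝ) + q := by linarith
  have hpow : ∀ r : ℝ, 0 < r → r ^ (N - 1) * r ^ α = r ^ ((N : ℝ) + α - 1) := by
    intro r hr
    rw [← Real.rpow_natCast, ← Real.rpow_add hr, Nat.cast_sub hN]
    congr 1; push_cast; ring
  rw [← Ioc_union_Ioi_eq_Ioi zero_le_one]
  refine IntegrableOn.union ?_ ?_
  · have h3 : IntegrableOn (fun r : ℝ => r ^ ((N : ℝ) + α - 1)) (Ioc 0 1) := by
      rw [← intervalIntegrable_iff_integrableOn_Ioc_of_le zero_le_one]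
      exact intervalIntegral.intervalIntegrable_rpow' (by linarith)
    refine Integrable.mono' h3 (Measurable.aestronglyMeasurable (by fun_prop)) ?_
    filter_upwards [ae_restrict_mem measurableSet_Ioc] with r hr
    have hr0 : 0 < r := hr.1
    rw [Real.norm_of_nonneg (by positivity), ← hpow r hr0, mul_div_assoc']
    exact div_le_self (by positivity) (Real.one_le_rpow (by linarith) hm)
  · have h3 : IntegrableOn (fun r : ℝ => r ^ (α - q - 1)) (Ioi 1) :=
      integrableOn_Ioi_rpow_of_lt (by linarith) one_pos
    refine Integrable.mono' h3 (Measurable.aestronglyMeasurable (by fun_prop)) ?_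
    filter_upwards [ae_restrict_mem measurableSet_Ioi] with r hr
    have hr0 : 0 < r := lt_trans one_pos hr
    rw [Real.norm_of_nonneg (by positivity), mul_div_assoc', hpow r hr0]
    calc _ ≤ r ^ ((N : ℝ) + α - 1) / r ^ ((N : ℝ) + q) := by gcongr; linarith
      _ = _ := by rw [← Real.rpow_sub hr0]; congr 1; ring

lemma memTailSpace_rpow {s p β : ℝ} (h1 : -(N : ℝ) < β * (p - 1))
    (h2 : β * (p - 1) < s * p) :
    MemTailSpace s p fun x : EuclideanSpace ℝ (Fin N) => ‖x‖ ^ β := by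
  refine memTailSpace_of_integrable (by fun_prop) ?_
  refine (integrable_norm_rpow_div h1 h2).congr (Filter.Eventually.of_forall fun x => ?_)
  simp only
  rw [abs_of_nonneg (by positivity), ← Real.rpow_mul (norm_nonneg _)]

lemma memTailSpace_log {s p : ℝ} (hs : 0 < s) (hp : 1 < p) :
    MemTailSpace s p fun x : EuclideanSpace ℝ (Fin N) => Real.log ‖x‖ := by
  have hN : 0 < N := by
    have := Module.finrank_pos (R := ℝ) (M := EuclideanSpace ℝ (Fin N)); simpa using this
  have hN' : (0 : ℝ) < N := by exact_mod_cast hN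
  have hq : 0 < s * p := by positivity
  have hp1 : 0 < p - 1 := by linarith
  -- The logarithm is bounded by small positive and negative powers.
  obtain ⟨η, hη0, hη⟩ : ∃ η : ℝ, 0 < η ∧ η < min (N : ℝ) (s * p) := exists_between (by positivity)
  obtain ⟨hηN, hηq⟩ := lt_min_iff.1 hη
  set ε := η / (p - 1) with hε_def
  have hε : 0 < ε := by positivity
  have hεp : ε * (p - 1) = η := div_mul_cancel₀ _ hp1.ne'
  refine memTailSpace_of_integrable (Real.measurable_log.comp measurable_norm) ?_
  have hb := ((integrable_norm_rpow_div (N := N) (by linarith : -(N : ℝ) < η) hηq).add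
    (integrable_norm_rpow_div (N := N) (by linarith : -(N : ℝ) < -η)
      (by linarith : -η < s * p))).const_mul (2 ^ (p - 1) * (ε ^ (p - 1))⁻¹)
  refine hb.mono' (Measurable.aestronglyMeasurable ?_) (Filter.Eventually.of_forall fun x => ?_)
  · have := Real.measurable_log
    fun_prop
  simp only [Pi.add_apply]
  rw [Real.norm_of_nonneg (by positivity), ← add_div, mul_div_assoc']
  gcongr
  rcases eq_or_ne x 0 with rfl | hx
  · simp only [norm_zero, Real.log_zero, abs_zero]
    rw [Real.zero_rpow hp1.ne']
    positivity
  have hr : 0 < ‖x‖ := norm_pos_iff.2 hx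
  have h1 := Real.log_le_rpow_div hr.le hε
  have h2 := Real.log_le_rpow_div (inv_pos.2 hr).le hε
  rw [Real.log_inv, Real.inv_rpow hr.le, ← Real.rpow_neg hr.le] at h2
  have hA : 0 < ‖x‖ ^ ε / ε := by positivity
  have hB : 0 < ‖x‖ ^ (-ε) / ε := by positivity
  have h3 : |Real.log ‖x‖| ≤ |‖x‖ ^ ε / ε - -(‖x‖ ^ (-ε) / ε)| := by
    rw [sub_neg_eq_add, abs_of_pos (add_pos hA hB), abs_le]
    constructor <;> linarith
  have h4 := abs_psiP_sub_le hp (‖x‖ ^ ε / ε) (-(‖x‖ ^ (-ε) / ε))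
  rw [abs_psiP hp, abs_neg, abs_of_pos hA, abs_of_pos hB, Real.div_rpow (by positivity) hε.le,
    Real.div_rpow (by positivity) hε.le, ← Real.rpow_mul hr.le, ← Real.rpow_mul hr.le, neg_mul,
    hεp] at h4
  calc _ ≤ _ := Real.rpow_le_rpow (abs_nonneg _) h3 hp1.le
    _ ≤ _ := h4
    _ = _ := by rw [div_eq_mul_inv, div_eq_mul_inv]; ring

end Tail

/-! ### The constant -/

lemma const_mul_constIntegrand {N : ℕ} (hN : 2 ≤ N) (s p β ρ : ℝ) :
    4 * Real.pi * alphaN N * constIntegrand N s p β ρ =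
      2 * profileDensity N p (s * p) β (fun r => r ^ β) ρ := by
  have h := const_mul_hyperG hN (s * p) (ρ ^ 2)
  rw [constIntegrand, profileDensity, sphereKernel, psiP, Real.one_rpow, mul_comm p s]
  linear_combination (|1 - ρ ^ β| ^ (p - 2) * (1 - ρ ^ β) *
    (ρ ^ ((N : ℝ) - 1) - ρ ^ (s * p - β * (p - 1) - 1))) * h

lemma alphaN_pos {N : ℕ} (hN : 2 ≤ N) : 0 < alphaN N := by
  have hN' : (2 : ℝ) ≤ N := by exact_mod_cast hN
  have : 0 < Real.Gamma (((N : ℝ) - 1) / 2) := Real.Gamma_pos_of_pos (by linarith)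
  have := Real.pi_pos
  unfold alphaN; positivity

/-- The constant `C(β)` as the value at `|x| = 1` of the operator applied to `|x| ^ β`. The factor
`2` is the one produced by the symmetry of the weak form. -/
lemma constC_eq {N : ℕ} (hN : 2 ≤ N) (s p β : ℝ) :
    constC N s p β = 2 * ∫ ρ in Ioo 0 1, profileDensity N p (s * p) β (fun r => r ^ β) ρ := by
  rw [constC, ← intervalIntegral.integral_const_mul]
  simp_rw [const_mul_constIntegrand hN]
  rw [intervalIntegral.integral_of_le zero_le_one, integral_Ioc_eq_integral_Ioo,
    integral_const_mul]

lemma setIntegral_Ioo_pos {f : ℝ → ℝ} (hf : IntegrableOn f (Ioo 0 1))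
    (hpos : ∀ ρ ∈ Ioo (0 : ℝ) 1, 0 < f ρ) : 0 < ∫ ρ in Ioo 0 1, f ρ := by
  rw [← integral_Ioc_eq_integral_Ioo, ← intervalIntegral.integral_of_le zero_le_one]
  exact intervalIntegral.intervalIntegral_pos_of_pos_on
    ((intervalIntegrable_iff_integrableOn_Ioo_of_le zero_le_one).2 hf) hpos one_pos

lemma psiP_pos (p : ℝ) {t : ℝ} (ht : 0 < t) : 0 < psiP p t := by
  unfold psiP; positivity

lemma psiP_lt_zero (p : ℝ) {t : ℝ} (ht : t < 0) : psiP p t < 0 := by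
  have := psiP_pos p (neg_pos.2 ht)
  rw [psiP_neg] at this; linarith

theorem theorem1 (N : ℕ) (hN : 2 ≤ N) (s p : ℝ) (hs0 : 0 < s) (hs1 : s < 1) (hp : 1 < p) :
    (p * s ≠ (N : ℝ) →
      ∀ β : ℝ, -(N : ℝ) / (p - 1) < β → β < p * s / (p - 1) →
        IntervalIntegrable (constIntegrand N s p β) volume 0 1 ∧
        IsWeakSolution s p ({0}ᶜ : Set (EuclideanSpace ℝ (Fin N)))
          (fun x _ => constC N s p β * ‖x‖ ^ (β * (p - 1) - s * p))
          (fun x => ‖x‖ ^ β) ∧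
        (β = 0 ∨ β = (p * s - N) / (p - 1) → constC N s p β = 0) ∧
        (min ((p * s - N) / (p - 1)) 0 < β ∧ β < max ((p * s - N) / (p - 1)) 0 →
          0 < constC N s p β) ∧
        (β < min ((p * s - N) / (p - 1)) 0 ∨ max ((p * s - N) / (p - 1)) 0 < β →
          constC N s p β < 0)) ∧
    (p * s = (N : ℝ) →
      IsWeakSolution s p ({0}ᶜ : Set (EuclideanSpace ℝ (Fin N)))
        (fun _ _ => 0) (fun x => Real.log ‖x‖)) := by
  have hN0 : 0 < N := by omega
  have : Nontrivial (EuclideanSpace ℝ (Fin N)) :=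
    Module.nontrivial_of_finrank_pos (R := ℝ) (by simpa using hN0)
  have hp1 : 0 < p - 1 := by linarith
  have hq : 0 < s * p := by positivity
  refine ⟨fun _ β hβ1 hβ2 => ?_, fun hpsN => ?_⟩
  · rw [div_lt_iff₀ hp1] at hβ1
    rw [lt_div_iff₀ hp1] at hβ2
    have hg := isHomogeneousProfile_rpow β
    have ht := memTailSpace_rpow (N := N) (s := s) (p := p) hβ1 (by linarith)
    have hint := integrableOn_profileDensity hs0 hs1 hp hg ht
    have hbr : ∀ ρ ∈ Ioo (0 : ℝ) 1, 0 < sphereKernel N (s * p) ρ := fun ρ hρ =>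
      sphereKernel_pos hN0 hq hρ.1.le hρ.2
    -- The signs of the two factors of the density other than the kernel.
    have hf1 : ∀ ρ ∈ Ioo (0 : ℝ) 1, 0 < β → 0 < psiP p ((1 : ℝ) ^ β - ρ ^ β) := fun ρ hρ h => by
      rw [Real.one_rpow]
      exact psiP_pos p (sub_pos.2 (Real.rpow_lt_one hρ.1.le hρ.2 h))
    have hf2 : ∀ ρ ∈ Ioo (0 : ℝ) 1, β < 0 → psiP p ((1 : ℝ) ^ β - ρ ^ β) < 0 := fun ρ hρ h => by
      rw [Real.one_rpow]
      exact psiP_lt_zero p (sub_neg.2 (Real.one_lt_rpow_of_pos_of_lt_one_of_neg hρ.1 hρ.2 h))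
    have hk1 : ∀ ρ ∈ Ioo (0 : ℝ) 1, β < (p * s - N) / (p - 1) →
        0 < ρ ^ ((N : ℝ) - 1) - ρ ^ (s * p - β * (p - 1) - 1) := fun ρ hρ h => by
      rw [lt_div_iff₀ hp1] at h
      exact sub_pos.2 (Real.rpow_lt_rpow_of_exponent_gt hρ.1 hρ.2 (by linarith))
    have hk2 : ∀ ρ ∈ Ioo (0 : ℝ) 1, (p * s - N) / (p - 1) < β →
        ρ ^ ((N : ℝ) - 1) - ρ ^ (s * p - β * (p - 1) - 1) < 0 := fun ρ hρ h => by
      rw [div_lt_iff₀ hp1] at h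
      exact sub_neg.2 (Real.rpow_lt_rpow_of_exponent_gt hρ.1 hρ.2 (by linarith))
    refine ⟨?_, ?_, ?_, ?_, ?_⟩
    · rw [intervalIntegrable_iff_integrableOn_Ioo_of_le zero_le_one]
      have hc : 4 * Real.pi * alphaN N ≠ 0 := by
        have := alphaN_pos hN
        have := Real.pi_pos
        positivity
      refine IntegrableOn.congr_fun ((hint.const_mul 2).const_mul (4 * Real.pi * alphaN N)⁻¹)
        (fun ρ _ => ?_) measurableSet_Ioo
      rw [← const_mul_constIntegrand hN, inv_mul_cancel_left₀ hc]
    · rw [constC_eq hN]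
      exact isWeakSolution_profile hs0 hs1 hp hg ht
    · intro h
      rw [constC_eq hN, setIntegral_congr_fun (g := fun _ => 0) measurableSet_Ioo, integral_zero,
        mul_zero]
      intro ρ hρ
      rcases h with rfl | h
      · simp [profileDensity, psiP_zero]
      · have : s * p - β * (p - 1) - 1 = (N : ℝ) - 1 := by
          rw [h, div_mul_cancel₀ _ hp1.ne']; ring
        simp only [profileDensity]
        rw [this, sub_self, mul_zero, zero_mul]
    · rintro ⟨h1, h2⟩
      rw [constC_eq hN]
      refine mul_pos two_pos (setIntegral_Ioo_pos hint fun ρ hρ => mul_pos ?_ (hbr ρ hρ))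
      rcases min_lt_iff.1 h1 with h1 | h1
      · rcases lt_max_iff.1 h2 with h2 | h2
        · linarith
        · exact mul_pos_of_neg_of_neg (hf2 ρ hρ h2) (hk2 ρ hρ h1)
      · rcases lt_max_iff.1 h2 with h2 | h2
        · exact mul_pos (hf1 ρ hρ h1) (hk1 ρ hρ h2)
        · linarith
    · intro h
      rw [constC_eq hN]
      have := setIntegral_Ioo_pos
        (f := fun ρ => -profileDensity N p (s * p) β (fun r => r ^ β) ρ) hint.neg
        fun ρ hρ => neg_pos.2
        (mul_neg_of_neg_of_pos (?_ : psiP p ((1 : ℝ) ^ β - ρ ^ β) *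
          (ρ ^ ((N : ℝ) - 1) - ρ ^ (s * p - β * (p - 1) - 1)) < 0) (hbr ρ hρ))
      · rw [integral_neg] at this
        linarith
      · rcases h with h | h
        · obtain ⟨h1, h2⟩ := lt_min_iff.1 h
          exact mul_neg_of_neg_of_pos (hf2 ρ hρ h2) (hk1 ρ hρ h1)
        · obtain ⟨h1, h2⟩ := max_lt_iff.1 h
          exact mul_neg_of_pos_of_neg (hf1 ρ hρ h2) (hk2 ρ hρ h1)
  · have h := isWeakSolution_profile (N := N) hs0 hs1 hp isHomogeneousProfile_log
      (memTailSpace_log hs0 hp)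
    have h0 : ∫ ρ in Ioo 0 1, profileDensity N p (s * p) 0 Real.log ρ = 0 := by
      rw [setIntegral_congr_fun (g := fun _ => 0) measurableSet_Ioo, integral_zero]
      intro ρ hρ
      simp only [profileDensity]
      rw [show s * p - 0 * (p - 1) - 1 = (N : ℝ) - 1 by linarith, sub_self, mul_zero, zero_mul]
    simpa only [h0, mul_zero, zero_mul] using h
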